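/- Let $d\ge 1$ be an integer, let $\|\cdot\|$ be a norm on $\mathbb{R}^d$, let $r>0$, and let $X$ be an $\mathbb{R}^d$-valued random vector that has a probability density function $f_X$ with respect to Lebesgue measure. Suppose that $f_X\log f_X$ is integrable, so that the differential entropy $h(X)=-\int_{\mathbb{R}^d} f_X(x)\log f_X(x)\,dx$ is finite; here $\log$ is the natural logarithm and $0\log 0=0$. For $D>0$ let $$R(D)=\inf_{P_{\hat X|X}\colon\ \mathbb{E}\|X-\hat X\|^r\le D} I(X;\hat X)\in[0,\infty]$$ be the rate-distortion function, the infimum being over all conditional distributions of an $\mathbb{R}^d$-valued $\hat X$ given $X$ that satisfy the constraint, where $I(X;\hat X)=D(P_{X,\hat X}\,\|\,P_X\times P_{\hat X})$ is the mutual information in nats. Let $$R_{\mathrm{SLB}}(D)=h(X)+\frac{d}{r}\log\frac1D-\frac{d}{r}\log\left(\frac{r}{d}\bigl(V_d\,\Gamma(1+d/r)\bigr)^{r/d}e\right)$$ be the Shannon lower bound, where $V_d$ is the Lebesgue volume of the unit ball $\{x\in\mathbb{R}^d:\|x\|\le 1\}$ and $\Gamma$ is the Gamma function. Let $H(\lfloor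 X\rfloor)=\sum_{i\in\mathbb{Z}^d}p_i\log(1/p_i)\in[0,\infty]$, with $p_i=\Pr(\lfloor X\rfloor=i)$, be the entropy of the componentwise integer part $\lfloor X\rfloor$ of $X$. If $H(\lfloor X\rfloor)<\infty$, then the Shannon lower bound is asymptotically tight, i.e. $$\lim_{D\downarrow 0}\bigl\{R(D)-R_{\mathrm{SLB}}(D)\bigr\}=0.$$ Conversely, if $H(\lfloor X\rfloor)=\infty$, then $R(D)=\infty$ for every $D>0$. Consequently, the Shannon lower bound is asymptotically tight if and only if $H(\lfloor X\rfloor)<\infty$. -/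

import Mathlib

open MeasureTheory ProbabilityTheory Filter Topology
open scoped ENNReal

noncomputable section

namespace RateDistortion

/-- The componentwise integer part of a real vector. -/
def floorVec {d : ℕ} (x : Fin d → ℝ) : Fin d → ℤ := fun i => ⌊x i⌋

/-- The entropy (in nats, with values in `[0, ∞]`) of a probability distribution `ν` on a
countable alphabet, `∑ i, ν{i} log (1 / ν{i})`. -/
def discreteEntropy {ι : Type*} [MeasurableSpace ι] (ν : Measure ι) : ℝ≥0∞ :=
  ∑' i, ENNReal.ofReal (Real.negMulLog (ν.real {i}))

/-- The entropy `H(⌊X⌋)` of the componentwise integer part of the random vector `X`. -/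
def floorEntropy {d : ℕ} {Ω : Type*} [MeasurableSpace Ω] (P : Measure Ω)
    (X : Ω → Fin d → ℝ) : ℝ≥0∞ :=
  discreteEntropy (P.map (fun ω => floorVec (X ω)))

/-- The function `x ↦ f_X(x) log f_X(x)`, where `f_X` is the density of `X` with respect to
Lebesgue measure. -/
def pdfLogPdf {d : ℕ} {Ω : Type*} [MeasurableSpace Ω] (P : Measure Ω)
    (X : Ω → Fin d → ℝ) (x : Fin d → ℝ) : ℝ :=
  (pdf X P volume x).toReal * Real.log (pdf X P volume x).toReal

/-- The differential entropy `h(X) = - ∫ f_X log f_X` (in nats). It is meaningful when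
`pdfLogPdf P X` is integrable. -/
def diffEntropy {d : ℕ} {Ω : Type*} [MeasurableSpace Ω] (P : Measure Ω)
    (X : Ω → Fin d → ℝ) : ℝ :=
  -∫ x, pdfLogPdf P X x

/-- The mutual information `I(X; Y) = D(P_{X,Y} ‖ P_X × P_Y)` (in nats, with values in `[0, ∞]`)
of two random variables with joint distribution `ρ`. -/
def mutualInfo {α β : Type*} [MeasurableSpace α] [MeasurableSpace β]
    (ρ : Measure (α × β)) : ℝ≥0∞ :=
  InformationTheory.klDiv ρ (ρ.fst.prod ρ.snd)

/-- The expected distortion `E ‖X - Y‖ ^ r` (with values in `[0, ∞]`) of a pair of random vectors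
with joint distribution `ρ`, for the norm `N`. -/
def expectedDistortion {d : ℕ} (N : Seminorm ℝ (Fin d → ℝ)) (r : ℝ)
    (ρ : Measure ((Fin d → ℝ) × (Fin d → ℝ))) : ℝ≥0∞ :=
  ∫⁻ p, ENNReal.ofReal (N (p.1 - p.2) ^ r) ∂ρ

/-- The rate-distortion function `R(D)`: the infimum of the mutual information over all
conditional distributions `κ` of the reconstruction given the source, under which the expected
distortion is at most `D`. Its values lie in `[0, ∞]`; the infimum of the empty set is `∞`. -/
def rateDistortion {d : ℕ} {Ω : Type*} [MeasurableSpace Ω] (P : Measure Ω)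
    (X : Ω → Fin d → ℝ) (N : Seminorm ℝ (Fin d → ℝ)) (r D : ℝ) : ℝ≥0∞ :=
  ⨅ (κ : Kernel (Fin d → ℝ) (Fin d → ℝ)) (_ : IsMarkovKernel κ)
    (_ : expectedDistortion N r ((P.map X) ⊗ₘ κ) ≤ ENNReal.ofReal D),
    mutualInfo ((P.map X) ⊗ₘ κ)

/-- The Lebesgue volume `V_d` of the closed unit ball of the norm `N`. -/
def unitBallVolume {d : ℕ} (N : Seminorm ℝ (Fin d → ℝ)) : ℝ :=
  volume.real {x : Fin d → ℝ | N x ≤ 1}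

/-- The Shannon lower bound
`h(X) + (d/r) log (1/D) - (d/r) log ((r/d) (V_d Γ(1 + d/r)) ^ (r/d) e)`. -/
def shannonLowerBound {d : ℕ} {Ω : Type*} [MeasurableSpace Ω] (P : Measure Ω)
    (X : Ω → Fin d → ℝ) (N : Seminorm ℝ (Fin d → ℝ)) (r D : ℝ) : ℝ :=
  diffEntropy P X + (d / r) * Real.log (1 / D)
    - (d / r) * Real.log ((r / d) *
        (unitBallVolume N * Real.Gamma (1 + d / r)) ^ (r / d) * Real.exp 1)

/-- The Shannon lower bound is asymptotically tight: `R(D) - R_SLB(D) → 0` as `D ↓ 0`. The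
difference is taken in the extended reals, since `R(D)` may be `∞`. -/
def SLBAsymptoticallyTight {d : ℕ} {Ω : Type*} [MeasurableSpace Ω] (P : Measure Ω)
    (X : Ω → Fin d → ℝ) (N : Seminorm ℝ (Fin d → ℝ)) (r : ℝ) : Prop :=
  Tendsto
    (fun D : ℝ => (rateDistortion P X N r D : EReal) - ((shannonLowerBound P X N r D : ℝ) : EReal))
    (𝓝[>] 0) (𝓝 0)

end RateDistortion

end

/-!
The Shannon lower bound is asymptotically tight exactly for sources whose integer part has finite
entropy. Let `μ` be the law of `X` and `f` its density.

*Lower bound.* The Donsker–Varadhan inequality `∫ g dρ ≤ D(ρ ‖ σ)` for `∫ exp g dσ ≤ 1`, applied to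
`g (x, y) = log (gibbsDensity (x - y) / f x)` with `gibbsDensity ∝ exp (-s N ^ r)` of `r`-th moment
`D`, gives `R(D) ≥ R_SLB(D)` for every `D` (`lower_bound_le_mutualInfo`). Applied to
`log (1 / p ⌊x⌋) - N(x - y) ^ r`, the same inequality bounds `H(⌊X⌋)` by the mutual information, the
distortion and a constant (`discreteEntropy_floorVec_ne_top`), so `H(⌊X⌋) = ∞` forces `R(D) = ∞`.

*Upper bound.* Reconstruct by `Y = X + Z`, with `Z` of density `gibbsDensity` and `r`-th moment `D`.
By the chain rule, `I(X; Y)` is at most the divergence of the joint law from `μ × Q`, for any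
output measure `Q` (`mutualInfo_le_klDiv_prod`). If `Q` has density `q`, this divergence equals
`R_SLB(D) - h(X) - E log q(X + Z) + ∫ q - 1`. It thus suffices to find, independently of `D`, a `q`
with nearly unit mass and `-E log q(X)` nearly `h(X)`, such that `E log q(X + Z) → E log q(X)` as
the noise is scaled down. Take `q = g + δ w`, with `g` continuous with compact support and close to `f`
in `L¹`, and `w` the smoothing of `μ` by `exp (-N)`. The function `log w` is `1`-Lipschitz for `N`,
and `H(⌊X⌋) < ∞` makes it `μ`-integrable; this provides the dominating functions for both
limits (`exists_continuous_output_density`, `tendsto_integral_log_add_noise`).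
-/

namespace RateDistortion

/-! ### Integrals of `exp (-s N ^ r)` -/

section NormIntegrals

variable {d : ℕ} (N : Seminorm ℝ (Fin d → ℝ))

lemma seminorm_le_sum (x : Fin d → ℝ) : N x ≤ ∑ i, |x i| * N (Pi.single i 1) := by
  have h : x = ∑ i, x i • (Pi.single i 1 : Fin d → ℝ) := by
    ext j
    simp [Finset.sum_apply, Pi.single_apply]
  calc N x = N (∑ i, x i • (Pi.single i 1 : Fin d → ℝ)) := by rw [← h]
    _ ≤ ∑ i, N (x i • (Pi.single i 1 : Fin d → ℝ)) :=
        Finset.le_sum_of_subadditive N (map_zero N).le (map_add_le_add N) _ _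
    _ = _ := by simp [map_smul_eq_mul]

lemma continuous_seminorm : Continuous N := by
  apply Seminorm.continuous_of_continuousAt_zero
  rw [ContinuousAt, map_zero]
  refine squeeze_zero (fun x => apply_nonneg N x) (seminorm_le_sum N) ?_
  have : Continuous fun x : Fin d → ℝ => ∑ i, |x i| * N (Pi.single i 1) := by fun_prop
  simpa using this.tendsto 0

lemma measurable_seminorm : Measurable N := (continuous_seminorm N).measurable

lemma continuous_seminorm_rpow {r : ℝ} (hr : 0 < r) : Continuous fun x => N x ^ r :=
  (continuous_seminorm N).rpow_const fun _ => Or.inr hr.le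

variable (hN : ∀ x, N x = 0 → x = 0)
include hN

lemma volume_lt_one_eq {r : ℝ} (hr : 0 < r) :
    volume {x : Fin d → ℝ | N x < 1} =
      .ofReal ((∫ x : Fin d → ℝ, Real.exp (-(N x) ^ r)) / Real.Gamma (1 + d / r)) := by
  have := measure_lt_one_eq_integral_div_gamma (volume : Measure (Fin d → ℝ)) (g := N)
    (map_zero N) (fun x => map_neg_eq_map N x) (map_add_le_add N) (fun {x} => hN x)
    (fun a x => by simp [map_smul_eq_mul]) hr
  simpa [add_comm] using this

lemma integral_exp_neg_rpow_pos {r : ℝ} (hr : 0 < r) :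
    0 < ∫ x : Fin d → ℝ, Real.exp (-(N x) ^ r) := by
  have hpos : 0 < volume {x : Fin d → ℝ | N x < 1} :=
    (isOpen_lt (continuous_seminorm N) continuous_const).measure_pos _ ⟨0, by simp⟩
  rw [volume_lt_one_eq N hN hr, ENNReal.ofReal_pos] at hpos
  have hG : 0 < Real.Gamma (1 + d / r) := Real.Gamma_pos_of_pos (by positivity)
  exact (div_pos_iff_of_pos_right hG).1 hpos

lemma integrable_exp_neg_rpow {r : ℝ} (hr : 0 < r) :
    Integrable fun x : Fin d → ℝ => Real.exp (-(N x) ^ r) := by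
  by_contra h
  exact (integral_exp_neg_rpow_pos N hN hr).ne' (integral_undef h)

lemma integral_exp_neg_rpow (hd : 1 ≤ d) {r : ℝ} (hr : 0 < r) :
    ∫ x : Fin d → ℝ, Real.exp (-(N x) ^ r) = unitBallVolume N * Real.Gamma (1 + d / r) := by
  have hG : 0 < Real.Gamma (1 + d / r) := Real.Gamma_pos_of_pos (by positivity)
  have : Nonempty (Fin d) := ⟨⟨0, hd⟩⟩
  have h := measure_le_eq_lt (volume : Measure (Fin d → ℝ)) (g := N)
    (map_zero N) (fun x => map_neg_eq_map N x) (map_add_le_add N) (fun {x} => hN x)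
    (fun a x => by simp [map_smul_eq_mul]) 1
  rw [unitBallVolume, measureReal_def, h, volume_lt_one_eq N hN hr, ENNReal.toReal_ofReal]
  · field_simp
  · exact div_nonneg (integral_exp_neg_rpow_pos N hN hr).le hG.le

lemma unitBallVolume_mul_Gamma_pos (hd : 1 ≤ d) {r : ℝ} (hr : 0 < r) :
    0 < unitBallVolume N * Real.Gamma (1 + d / r) :=
  integral_exp_neg_rpow N hN hd hr ▸ integral_exp_neg_rpow_pos N hN hr

omit hN in
lemma exp_neg_mul_rpow_eq {r s : ℝ} (hr : 0 < r) (hs : 0 < s) (x : Fin d → ℝ) :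
    Real.exp (-(s * N x ^ r)) = Real.exp (-(N (s ^ (1 / r) • x)) ^ r) := by
  rw [map_smul_eq_mul, Real.norm_of_nonneg (by positivity),
    Real.mul_rpow (by positivity) (apply_nonneg N x), ← Real.rpow_mul hs.le,
    one_div_mul_cancel hr.ne', Real.rpow_one]

lemma integrable_exp_neg_mul_rpow {r s : ℝ} (hr : 0 < r) (hs : 0 < s) :
    Integrable fun x : Fin d → ℝ => Real.exp (-(s * N x ^ r)) := by
  simp_rw [exp_neg_mul_rpow_eq N hr hs]
  exact (integrable_comp_smul_iff volume (fun x : Fin d → ℝ => Real.exp (-(N x) ^ r))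
    (by positivity)).2 (integrable_exp_neg_rpow N hN hr)

lemma integral_exp_neg_mul_rpow (hd : 1 ≤ d) {r s : ℝ} (hr : 0 < r) (hs : 0 < s) :
    ∫ x : Fin d → ℝ, Real.exp (-(s * N x ^ r)) =
      s ^ (-(d / r : ℝ)) * (unitBallVolume N * Real.Gamma (1 + d / r)) := by
  simp_rw [exp_neg_mul_rpow_eq N hr hs]
  rw [Measure.integral_comp_smul volume (fun x : Fin d → ℝ => Real.exp (-(N x) ^ r)),
    integral_exp_neg_rpow N hN hd hr, smul_eq_mul, Module.finrank_fin_fun,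
    abs_of_nonneg (by positivity), Real.rpow_neg hs.le, ← Real.rpow_natCast, ← Real.rpow_mul hs.le]
  congr 3
  ring

lemma integrable_rpow_mul_exp {r s : ℝ} (hr : 0 < r) (hs : 0 < s) :
    Integrable fun x : Fin d → ℝ => N x ^ r * Real.exp (-(s * N x ^ r)) := by
  refine ((integrable_exp_neg_mul_rpow N hN hr (half_pos hs)).const_mul (2 / s)).mono'
    ((continuous_seminorm_rpow N hr).mul
      (by have := continuous_seminorm_rpow N hr; fun_prop)).aestronglyMeasurable ?_
  refine ae_of_all _ fun x => ?_
  have ht : 0 ≤ N x ^ r := Real.rpow_nonneg (apply_nonneg N x) r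
  rw [Real.norm_of_nonneg (by positivity)]
  have h1 : s / 2 * N x ^ r ≤ Real.exp (s / 2 * N x ^ r) := by
    linarith [Real.add_one_le_exp (s / 2 * N x ^ r)]
  have h2 : Real.exp (-(s * N x ^ r)) =
      Real.exp (-(s / 2 * N x ^ r)) * Real.exp (-(s / 2 * N x ^ r)) := by
    rw [← Real.exp_add]; ring_nf
  have h3 : N x ^ r ≤ 2 / s * Real.exp (s / 2 * N x ^ r) := by
    rw [div_mul_eq_mul_div, le_div_iff₀ hs]; linarith
  calc N x ^ r * Real.exp (-(s * N x ^ r))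
      ≤ 2 / s * Real.exp (s / 2 * N x ^ r) * Real.exp (-(s * N x ^ r)) := by gcongr
    _ = 2 / s * Real.exp (-(s / 2 * N x ^ r)) *
        (Real.exp (s / 2 * N x ^ r) * Real.exp (-(s / 2 * N x ^ r))) := by rw [h2]; ring
    _ = _ := by rw [← Real.exp_add, add_neg_cancel, Real.exp_zero, mul_one]

/-- By convexity of `exp`, `t ↦ ∫ exp (-t N ^ r) + (t - s) ∫ N ^ r exp (-s N ^ r)` is minimal at
`t = s`, so its derivative vanishes there; this identifies the `r`-th moment with the derivative
of the explicit normalization constant. -/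
lemma integral_rpow_mul_exp (hd : 1 ≤ d) {r s : ℝ} (hr : 0 < r) (hs : 0 < s) :
    ∫ x : Fin d → ℝ, N x ^ r * Real.exp (-(s * N x ^ r)) =
      d / r / s * ∫ x : Fin d → ℝ, Real.exp (-(s * N x ^ r)) := by
  set M := ∫ x : Fin d → ℝ, N x ^ r * Real.exp (-(s * N x ^ r)) with hM
  set A := unitBallVolume N * Real.Gamma (1 + d / r) with hA
  have key : ∀ t, 0 < t → s ^ (-(d / r : ℝ)) * A ≤ t ^ (-(d / r : ℝ)) * A + (t - s) * M := by
    intro t ht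
    rw [hA, ← integral_exp_neg_mul_rpow N hN hd hr hs, ← integral_exp_neg_mul_rpow N hN hd hr ht,
      hM, ← integral_const_mul, ← integral_add (integrable_exp_neg_mul_rpow N hN hr ht)
        ((integrable_rpow_mul_exp N hN hr hs).const_mul _)]
    refine integral_mono (integrable_exp_neg_mul_rpow N hN hr hs)
      ((integrable_exp_neg_mul_rpow N hN hr ht).add
        ((integrable_rpow_mul_exp N hN hr hs).const_mul _)) fun x => ?_
    have h1 : Real.exp (-(t * N x ^ r)) =
        Real.exp (-((t - s) * N x ^ r)) * Real.exp (-(s * N x ^ r)) := by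
      rw [← Real.exp_add]; ring_nf
    have h2 := Real.add_one_le_exp (-((t - s) * N x ^ r))
    have h3 := Real.exp_pos (-(s * N x ^ r))
    simp only [h1]
    nlinarith
  have hmin : IsLocalMin (fun t : ℝ => t ^ (-(d / r : ℝ)) * A + (t - s) * M) s := by
    filter_upwards [lt_mem_nhds hs] with t ht
    simpa using key t ht
  have hder : HasDerivAt (fun t : ℝ => t ^ (-(d / r : ℝ)) * A + (t - s) * M)
      (-(d / r : ℝ) * s ^ (-(d / r : ℝ) - 1) * A + 1 * M) s :=
    ((Real.hasDerivAt_rpow_const (Or.inl hs.ne')).mul_const A).add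
      (((hasDerivAt_id s).sub_const s).mul_const M)
  have h0 := hmin.hasDerivAt_eq_zero hder
  rw [integral_exp_neg_mul_rpow N hN hd hr hs, ← hA]
  rw [Real.rpow_sub_one hs.ne'] at h0
  have : M = (d / r : ℝ) * (s ^ (-(d / r : ℝ)) / s) * A := by linarith
  rw [this]; ring

end NormIntegrals

/-! ### Variational bounds for divergence and mutual information -/

section Divergence

open InformationTheory

variable {α β : Type*} [MeasurableSpace α] [MeasurableSpace β]

/-- The Fenchel–Young inequality for `klFun`, whose convex conjugate is `u ↦ exp u - 1`. -/
lemma mul_le_klFun_add_exp {t : ℝ} (ht : 0 ≤ t) (u : ℝ) : t * u + 1 ≤ klFun t + Real.exp u := by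
  rw [klFun_apply]
  rcases ht.eq_or_lt with rfl | ht
  · simp [(Real.exp_pos u).le]
  · have h := Real.add_one_le_exp (u - Real.log t)
    have h2 : Real.exp u = t * Real.exp (u - Real.log t) := by
      rw [Real.exp_sub, Real.exp_log ht]; field_simp
    rw [h2]
    nlinarith

/-- The Donsker–Varadhan inequality for the test function `a - b`, in a form without subtraction
that needs no integrability. -/
lemma lintegral_add_le_klDiv {ρ σ : Measure α} [IsFiniteMeasure ρ] [IsFiniteMeasure σ]
    {a b : α → ℝ} (ha : Measurable a) (hb : Measurable b) (ha0 : ∀ x, 0 ≤ a x)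
    (hb0 : ∀ x, 0 ≤ b x) :
    ∫⁻ x, ENNReal.ofReal (a x) ∂ρ + σ Set.univ ≤
      klDiv ρ σ + ∫⁻ x, ENNReal.ofReal (Real.exp (a x - b x)) ∂σ
        + ∫⁻ x, ENNReal.ofReal (b x) ∂ρ := by
  by_cases hac : ρ ≪ σ
  swap; · simp [klDiv_of_not_ac hac]
  have hD : Measurable (ρ.rnDeriv σ) := Measure.measurable_rnDeriv ρ σ
  have conv : ∀ u : α → ℝ, Measurable u → (∀ x, 0 ≤ u x) → ∫⁻ x, ENNReal.ofReal (u x) ∂ρ =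
      ∫⁻ x, ENNReal.ofReal ((ρ.rnDeriv σ x).toReal * u x) ∂σ := by
    intro u hu hu0
    rw [← lintegral_rnDeriv_mul hac hu.ennreal_ofReal.aemeasurable]
    refine lintegral_congr_ae ?_
    filter_upwards [ρ.rnDeriv_lt_top σ] with x hx
    rw [ENNReal.ofReal_mul ENNReal.toReal_nonneg, ENNReal.ofReal_toReal hx.ne]
  rw [conv a ha ha0, conv b hb hb0, klDiv_eq_lintegral_klFun_of_ac hac, ← lintegral_one,
    ← lintegral_add_right _ measurable_const, ← lintegral_add_right _ (by fun_prop),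
    ← lintegral_add_right _ (by fun_prop)]
  refine lintegral_mono fun x => ?_
  have h0 : (0 : ℝ) ≤ (ρ.rnDeriv σ x).toReal := ENNReal.toReal_nonneg
  rw [← ENNReal.ofReal_one, ← ENNReal.ofReal_add (mul_nonneg h0 (ha0 x)) zero_le_one,
    ← ENNReal.ofReal_add (klFun_nonneg h0) (Real.exp_pos _).le,
    ← ENNReal.ofReal_add (add_nonneg (klFun_nonneg h0) (Real.exp_pos _).le)
      (mul_nonneg h0 (hb0 x))]
  refine ENNReal.ofReal_le_ofReal ?_
  have := mul_le_klFun_add_exp h0 (a x - b x)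
  linarith

/-- The Donsker–Varadhan inequality for an integrable test function `g`. -/
lemma integral_le_toReal_klDiv {ρ σ : Measure α} [IsFiniteMeasure ρ] [IsProbabilityMeasure σ]
    {g : α → ℝ} (hg : Measurable g) (hint : Integrable g ρ)
    (hexp : ∫⁻ x, ENNReal.ofReal (Real.exp (g x)) ∂σ ≤ 1) (htop : klDiv ρ σ ≠ ∞) :
    ∫ x, g x ∂ρ ≤ (klDiv ρ σ).toReal := by
  have h := lintegral_add_le_klDiv (ρ := ρ) (σ := σ) (a := fun x => max (g x) 0)
    (b := fun x => max (-g x) 0) (by fun_prop) (by fun_prop) (fun x => le_max_right _ _)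
    (fun x => le_max_right _ _)
  have hsub : ∀ x, max (g x) 0 - max (-g x) 0 = g x := fun x => by
    rcases le_total (g x) 0 with h | h <;> simp [h]
  have hmax : ∀ y : ℝ, ENNReal.ofReal (max y 0) = ENNReal.ofReal y := fun y => by
    rcases le_total y 0 with h | h <;> simp [h, ENNReal.ofReal_of_nonpos]
  simp only [hsub, hmax, measure_univ] at h
  have h1 : ∫⁻ x, ENNReal.ofReal (g x) ∂ρ ≤ klDiv ρ σ + ∫⁻ x, ENNReal.ofReal (-g x) ∂ρ := by
    have h2 : ∫⁻ x, ENNReal.ofReal (g x) ∂ρ + 1 ≤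
        klDiv ρ σ + ∫⁻ x, ENNReal.ofReal (-g x) ∂ρ + 1 := by
      refine h.trans ?_
      rw [add_right_comm]
      gcongr
    exact (ENNReal.add_le_add_iff_right ENNReal.one_ne_top).1 h2
  have hneg : ∫⁻ x, ENNReal.ofReal (-g x) ∂ρ ≠ ∞ := hint.neg.lintegral_lt_top.ne
  rw [integral_eq_lintegral_pos_part_sub_lintegral_neg_part hint]
  have h3 := ENNReal.toReal_mono (ENNReal.add_ne_top.2 ⟨htop, hneg⟩) h1
  rw [ENNReal.toReal_add htop hneg] at h3
  linarith

lemma klDiv_map_measurableEquiv (e : α ≃ᵐ β) (ρ σ : Measure α) [IsFiniteMeasure ρ]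
    [IsFiniteMeasure σ] : klDiv (ρ.map e) (σ.map e) = klDiv ρ σ := by
  refine le_antisymm (klDiv_map_le ρ σ e.measurable) ?_
  have := klDiv_map_le (ρ.map e) (σ.map e) e.symm.measurable
  simpa using this

/-- The mutual information is at most the divergence from any product measure whose first factor
is the first marginal: the difference of the two is the divergence of the second marginals. -/
lemma mutualInfo_le_klDiv_prod [StandardBorelSpace α] [Nonempty α]
    (ρ : Measure (α × β)) [IsProbabilityMeasure ρ] (Q : Measure β) [IsFiniteMeasure Q] :
    mutualInfo ρ ≤ klDiv ρ (ρ.fst.prod Q) := by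
  have hprod : ∀ τ : Measure β, IsFiniteMeasure τ → klDiv ρ (ρ.fst.prod τ) =
      klDiv (ρ.map Prod.swap) (τ ⊗ₘ Kernel.const β ρ.fst) := by
    intro τ _
    rw [← klDiv_map_measurableEquiv MeasurableEquiv.prodComm, Measure.compProd_const]
    congr 1
    exact Measure.prod_swap
  have hdis : ρ.map Prod.swap = ρ.snd ⊗ₘ (ρ.map Prod.swap).condKernel := by
    conv_lhs => rw [← (ρ.map Prod.swap).disintegrate (ρ.map Prod.swap).condKernel]
    congr 1
    exact Measure.fst_map_swap
  rw [mutualInfo, hprod _ inferInstance, hprod Q inferInstance, hdis]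
  rw [klDiv_compProd_eq_add ρ.snd Q]
  exact le_add_self

end Divergence

/-! ### The maximum entropy density -/

section GibbsDensity

variable {d : ℕ}

/-- The probability density proportional to `exp (-s N(x) ^ r)`: it maximizes the differential
entropy among the densities with the same `r`-th moment of the norm `N`. -/
noncomputable def gibbsDensity (N : Seminorm ℝ (Fin d → ℝ)) (r s : ℝ) (x : Fin d → ℝ) : ℝ :=
  Real.exp (-(s * N x ^ r)) / ∫ z : Fin d → ℝ, Real.exp (-(s * N z ^ r))

variable (N : Seminorm ℝ (Fin d → ℝ)) {r s : ℝ}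

lemma continuous_gibbsDensity (hr : 0 < r) (s : ℝ) : Continuous (gibbsDensity N r s) := by
  have := continuous_seminorm_rpow N hr
  unfold gibbsDensity
  fun_prop

lemma measurable_gibbsDensity (hr : 0 < r) (s : ℝ) : Measurable (gibbsDensity N r s) :=
  (continuous_gibbsDensity N hr s).measurable

variable (hN : ∀ x, N x = 0 → x = 0) (hd : 1 ≤ d) (hr : 0 < r) (hs : 0 < s)
include hN hd hr hs

lemma integral_exp_neg_mul_rpow_pos : 0 < ∫ z : Fin d → ℝ, Real.exp (-(s * N z ^ r)) := by
  rw [integral_exp_neg_mul_rpow N hN hd hr hs]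
  exact mul_pos (Real.rpow_pos_of_pos hs _) (unitBallVolume_mul_Gamma_pos N hN hd hr)

lemma gibbsDensity_pos (x : Fin d → ℝ) : 0 < gibbsDensity N r s x :=
  div_pos (Real.exp_pos _) (integral_exp_neg_mul_rpow_pos N hN hd hr hs)

omit hd in
lemma integrable_gibbsDensity : Integrable (gibbsDensity N r s) :=
  (integrable_exp_neg_mul_rpow N hN hr hs).div_const _

lemma integral_gibbsDensity : ∫ x, gibbsDensity N r s x = 1 := by
  unfold gibbsDensity
  rw [integral_div, div_self (integral_exp_neg_mul_rpow_pos N hN hd hr hs).ne']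

lemma lintegral_gibbsDensity : ∫⁻ x, ENNReal.ofReal (gibbsDensity N r s x) = 1 := by
  rw [← ofReal_integral_eq_lintegral_ofReal (integrable_gibbsDensity N hN hr hs)
    (ae_of_all _ fun x => (gibbsDensity_pos N hN hd hr hs x).le),
    integral_gibbsDensity N hN hd hr hs, ENNReal.ofReal_one]

omit hd in
lemma integrable_rpow_mul_gibbsDensity : Integrable fun x => N x ^ r * gibbsDensity N r s x := by
  simp_rw [gibbsDensity, mul_div_assoc']
  exact (integrable_rpow_mul_exp N hN hr hs).div_const _

lemma integral_rpow_mul_gibbsDensity :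
    ∫ x, N x ^ r * gibbsDensity N r s x = d / r / s := by
  simp_rw [gibbsDensity, mul_div_assoc']
  rw [integral_div, integral_rpow_mul_exp N hN hd hr hs, mul_div_assoc,
    div_self (integral_exp_neg_mul_rpow_pos N hN hd hr hs).ne', mul_one]

lemma log_gibbsDensity (x : Fin d → ℝ) :
    Real.log (gibbsDensity N r s x) =
      -(s * N x ^ r) + (d / r * Real.log s
        - Real.log (unitBallVolume N * Real.Gamma (1 + d / r))) := by
  rw [gibbsDensity, Real.log_div (Real.exp_pos _).ne'
    (integral_exp_neg_mul_rpow_pos N hN hd hr hs).ne', Real.log_exp,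
    integral_exp_neg_mul_rpow N hN hd hr hs,
    Real.log_mul (Real.rpow_pos_of_pos hs _).ne' (unitBallVolume_mul_Gamma_pos N hN hd hr).ne',
    Real.log_rpow hs]
  ring

end GibbsDensity

/-! ### The Shannon lower bound for a channel -/

section LowerBound

variable {d : ℕ}

lemma shannonLowerBound_eq {Ω : Type*} [MeasurableSpace Ω] (P : Measure Ω)
    (X : Ω → Fin d → ℝ) (N : Seminorm ℝ (Fin d → ℝ)) (hN : ∀ x, N x = 0 → x = 0) (hd : 1 ≤ d)
    {r D : ℝ} (hr : 0 < r) (hD : 0 < D) :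
    shannonLowerBound P X N r D = diffEntropy P X + (d / r * Real.log (d / (r * D))
        - Real.log (unitBallVolume N * Real.Gamma (1 + d / r))) - d / r := by
  have hA := unitBallVolume_mul_Gamma_pos N hN hd hr
  have hd' : (0 : ℝ) < d := by exact_mod_cast hd
  rw [shannonLowerBound, Real.log_mul (by positivity) (Real.exp_pos 1).ne', Real.log_exp,
    Real.log_mul (by positivity) (by positivity), Real.log_rpow hA, Real.log_div hr.ne' hd'.ne',
    Real.log_div one_ne_zero hD.ne', Real.log_one, Real.log_div hd'.ne' (by positivity),
    Real.log_mul hr.ne' hD.ne']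
  field_simp
  ring

lemma integrable_fst_compProd {μ : Measure (Fin d → ℝ)} [IsProbabilityMeasure μ]
    {κ : Kernel (Fin d → ℝ) (Fin d → ℝ)} [IsMarkovKernel κ] {g : (Fin d → ℝ) → ℝ}
    (hg : Integrable g μ) : Integrable (fun p => g p.1) (μ ⊗ₘ κ) := by
  have h : (μ ⊗ₘ κ).map Prod.fst = μ := Measure.fst_compProd μ κ
  rw [← h] at hg
  exact hg.comp_measurable measurable_fst

lemma integral_fst_compProd {μ : Measure (Fin d → ℝ)} [IsProbabilityMeasure μ]
    {κ : Kernel (Fin d → ℝ) (Fin d → ℝ)} [IsMarkovKernel κ] {g : (Fin d → ℝ) → ℝ}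
    (hg : Measurable g) : ∫ p, g p.1 ∂(μ ⊗ₘ κ) = ∫ x, g x ∂μ := by
  have h : (μ ⊗ₘ κ).map Prod.fst = μ := Measure.fst_compProd μ κ
  conv_rhs => rw [← h]
  rw [integral_map measurable_fst.aemeasurable hg.aestronglyMeasurable]

/-- The Shannon lower bound for a single channel, from the Donsker–Varadhan inequality with the
test function `log (g (x - y) / f x)`, where `g` is the Gibbs density with `r`-th moment `D`. -/
lemma lower_bound_le_mutualInfo (N : Seminorm ℝ (Fin d → ℝ)) (hN : ∀ x, N x = 0 → x = 0)
    (hd : 1 ≤ d) {r D : ℝ} (hr : 0 < r) (hD : 0 < D) {μ : Measure (Fin d → ℝ)}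
    [IsProbabilityMeasure μ] {f : (Fin d → ℝ) → ℝ} (hf : Measurable f) (hf0 : ∀ x, 0 ≤ f x)
    (hμ : μ = volume.withDensity fun x => ENNReal.ofReal (f x))
    (hlog : Integrable (fun x => Real.log (f x)) μ)
    (κ : Kernel (Fin d → ℝ) (Fin d → ℝ)) [IsMarkovKernel κ]
    (hdist : expectedDistortion N r (μ ⊗ₘ κ) ≤ ENNReal.ofReal D)
    (htop : mutualInfo (μ ⊗ₘ κ) ≠ ∞) :
    -∫ x, Real.log (f x) ∂μ + (d / r * Real.log (d / (r * D))
        - Real.log (unitBallVolume N * Real.Gamma (1 + d / r))) - d / r ≤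
      (mutualInfo (μ ⊗ₘ κ)).toReal := by
  have hd' : (0 : ℝ) < d := by exact_mod_cast hd
  set s : ℝ := d / (r * D) with hs_def
  have hs : 0 < s := by positivity
  set A : ℝ := d / r * Real.log s - Real.log (unitBallVolume N * Real.Gamma (1 + d / r)) with hA
  have hN0 : ∀ x, 0 ≤ N x ^ r := fun x => Real.rpow_nonneg (apply_nonneg N x) r
  have hNm : Measurable fun p : (Fin d → ℝ) × (Fin d → ℝ) => N (p.1 - p.2) ^ r :=
    (continuous_seminorm_rpow N hr).measurable.comp (measurable_fst.sub measurable_snd)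
  have hNint : Integrable (fun p : (Fin d → ℝ) × (Fin d → ℝ) => N (p.1 - p.2) ^ r) (μ ⊗ₘ κ) := by
    refine ⟨hNm.aestronglyMeasurable, ?_⟩
    rw [hasFiniteIntegral_iff_ofReal (ae_of_all _ fun p => hN0 _)]
    exact hdist.trans_lt ENNReal.ofReal_lt_top
  have hNle : ∫ p, N (p.1 - p.2) ^ r ∂(μ ⊗ₘ κ) ≤ D := by
    rw [integral_eq_lintegral_of_nonneg_ae (ae_of_all _ fun p => hN0 _) hNm.aestronglyMeasurable]
    exact ENNReal.toReal_le_of_le_ofReal hD.le hdist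
  let g : (Fin d → ℝ) × (Fin d → ℝ) → ℝ := fun p =>
    -Real.log (f p.1) + Real.log (gibbsDensity N r s (p.1 - p.2))
  have hGm := measurable_gibbsDensity N hr s
  have hgm : Measurable g := by fun_prop
  have hgeq : ∀ p, g p = -Real.log (f p.1) + (-(s * N (p.1 - p.2) ^ r) + A) := fun p => by
    simp only [g]; rw [log_gibbsDensity N hN hd hr hs]
  have hlog1 := integrable_fst_compProd (κ := κ) hlog
  have hrest : Integrable (fun p : (Fin d → ℝ) × (Fin d → ℝ) => -(s * N (p.1 - p.2) ^ r) + A)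
      (μ ⊗ₘ κ) := (hNint.const_mul s).neg.add (integrable_const A)
  have hgint : Integrable g (μ ⊗ₘ κ) := by
    rw [show g = _ from funext hgeq]
    exact hlog1.neg.add hrest
  have hexp : ∫⁻ p, ENNReal.ofReal (Real.exp (g p))
      ∂((μ ⊗ₘ κ).fst.prod (μ ⊗ₘ κ).snd) ≤ 1 := by
    rw [Measure.fst_compProd, lintegral_prod_symm _ (by fun_prop)]
    calc ∫⁻ y, ∫⁻ x, ENNReal.ofReal (Real.exp (g (x, y))) ∂μ ∂(μ ⊗ₘ κ).snd
        ≤ ∫⁻ _, 1 ∂(μ ⊗ₘ κ).snd := lintegral_mono fun y => ?_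
      _ = 1 := by simp
    rw [hμ, lintegral_withDensity_eq_lintegral_mul _ (by fun_prop) (by fun_prop)]
    calc _ ≤ ∫⁻ x, ENNReal.ofReal (gibbsDensity N r s (x - y)) := lintegral_mono fun x => ?_
      _ = 1 := by
        rw [lintegral_sub_right_eq_self (fun x => ENNReal.ofReal (gibbsDensity N r s x)) y,
          lintegral_gibbsDensity N hN hd hr hs]
    simp only [Pi.mul_apply, g]
    rw [← ENNReal.ofReal_mul (hf0 x)]
    refine ENNReal.ofReal_le_ofReal ?_
    have hG := gibbsDensity_pos N hN hd hr hs (x - y)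
    rw [Real.exp_add, Real.exp_log hG, Real.exp_neg]
    rcases (hf0 x).eq_or_lt with h0 | h0
    · rw [← h0]; simpa using hG.le
    · rw [Real.exp_log h0, mul_inv_cancel_left₀ h0.ne']
  have key := integral_le_toReal_klDiv hgm hgint hexp htop
  have hval : ∫ p, g p ∂(μ ⊗ₘ κ) =
      -∫ x, Real.log (f x) ∂μ + (-(s * ∫ p, N (p.1 - p.2) ^ r ∂(μ ⊗ₘ κ)) + A) := by
    calc ∫ p, g p ∂(μ ⊗ₘ κ)
        = ∫ p, -Real.log (f p.1) + (-(s * N (p.1 - p.2) ^ r) + A) ∂(μ ⊗ₘ κ) := by simp_rw [hgeq]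
      _ = ∫ p, -Real.log (f p.1) ∂(μ ⊗ₘ κ) +
          ∫ p, -(s * N (p.1 - p.2) ^ r) + A ∂(μ ⊗ₘ κ) := integral_add hlog1.neg hrest
      _ = ∫ p, -Real.log (f p.1) ∂(μ ⊗ₘ κ) +
          (∫ p, -(s * N (p.1 - p.2) ^ r) ∂(μ ⊗ₘ κ) + ∫ _, A ∂(μ ⊗ₘ κ)) :=
          congrArg _ (integral_add (hNint.const_mul s).neg (integrable_const A))
      _ = _ := by
          rw [integral_neg, integral_neg, integral_const_mul, integral_fst_compProd hf.log]
          simp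
  have hsD : s * D = d / r := by rw [hs_def]; field_simp
  have := mul_le_mul_of_nonneg_left hNle hs.le
  rw [mutualInfo]
  linarith

end LowerBound

/-! ### Finite rate forces finite entropy of the integer part -/

section InfiniteRate

variable {d : ℕ}

lemma measurable_floorVec : Measurable (floorVec : (Fin d → ℝ) → Fin d → ℤ) :=
  measurable_pi_lambda _ fun i => (measurable_pi_apply i).floor

lemma lintegral_comp_floorVec (μ : Measure (Fin d → ℝ)) (F : (Fin d → ℤ) → ℝ≥0∞) :
    ∫⁻ x, F (floorVec x) ∂μ = ∑' i, F i * μ.map floorVec {i} := by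
  rw [← lintegral_map (Measurable.of_discrete (f := F)) measurable_floorVec, lintegral_countable']

lemma lintegral_negLog_floorVec (μ : Measure (Fin d → ℝ)) [IsProbabilityMeasure μ] :
    ∫⁻ x, ENNReal.ofReal (-Real.log ((μ.map floorVec).real {floorVec x})) ∂μ =
      discreteEntropy (μ.map floorVec) := by
  rw [lintegral_comp_floorVec μ fun i => ENNReal.ofReal (-Real.log ((μ.map floorVec).real {i})),
    discreteEntropy]
  have := Measure.isProbabilityMeasure_map (μ := μ) measurable_floorVec.aemeasurable
  refine tsum_congr fun i => ?_
  rw [Real.negMulLog, neg_mul_comm, mul_comm, ENNReal.ofReal_mul measureReal_nonneg,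
    ofReal_measureReal]

lemma floorVec_preimage_singleton (i : Fin d → ℤ) :
    floorVec ⁻¹' {i} = Set.pi Set.univ fun k => Set.Ico (i k : ℝ) (i k + 1) := by
  ext x
  simp [floorVec, funext_iff, Int.floor_eq_iff, Set.mem_pi]

lemma volume_floorVec_preimage_singleton (i : Fin d → ℤ) :
    volume (floorVec ⁻¹' {i}) = 1 := by
  rw [floorVec_preimage_singleton, Real.volume_pi_Ico]
  simp

lemma seminorm_sub_le_of_floorVec_eq (N : Seminorm ℝ (Fin d → ℝ)) {x y : Fin d → ℝ}
    (h : floorVec x = floorVec y) : N (x - y) ≤ ∑ i, N (Pi.single i 1) := by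
  refine (seminorm_le_sum N _).trans (Finset.sum_le_sum fun i _ => ?_)
  refine mul_le_of_le_one_left (apply_nonneg N _) ?_
  exact (Int.abs_sub_lt_one_of_floor_eq_floor (congrFun h i)).le

lemma exp_neg_rpow_le_of_floorVec_eq (N : Seminorm ℝ (Fin d → ℝ)) {r : ℝ} (hr : 0 < r)
    {x x' : Fin d → ℝ} (y : Fin d → ℝ) (h : floorVec x' = floorVec x) :
    Real.exp (-(N (x - y)) ^ r) ≤ Real.exp ((∑ i, N (Pi.single i 1)) ^ r) *
      Real.exp (-((2 ^ r)⁻¹ * N (x' - y) ^ r)) := by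
  rw [← Real.exp_add, Real.exp_le_exp]
  set K := ∑ i, N (Pi.single i 1)
  have hK : N (x' - x) ≤ K := seminorm_sub_le_of_floorVec_eq N h
  have hK0 : 0 ≤ K := (apply_nonneg N _).trans hK
  have h0 := apply_nonneg N (x - y)
  have h1 : N (x' - y) ≤ N (x' - x) + N (x - y) := by
    simpa using map_add_le_add N (x' - x) (x - y)
  have h2 : N (x' - y) ≤ 2 * max K (N (x - y)) := by
    linarith [le_max_left K (N (x - y)), le_max_right K (N (x - y))]
  have h3 : N (x' - y) ^ r ≤ 2 ^ r * (K ^ r + N (x - y) ^ r) := by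
    calc N (x' - y) ^ r ≤ (2 * max K (N (x - y))) ^ r :=
          Real.rpow_le_rpow (apply_nonneg N _) h2 hr.le
      _ = 2 ^ r * max K (N (x - y)) ^ r := Real.mul_rpow (by norm_num) (hK0.trans (le_max_left _ _))
      _ ≤ 2 ^ r * (K ^ r + N (x - y) ^ r) := by
          gcongr
          rcases max_cases K (N (x - y)) with ⟨h, -⟩ | ⟨h, -⟩ <;> rw [h]
          · linarith [Real.rpow_nonneg h0 r]
          · linarith [Real.rpow_nonneg hK0 r]
  have h4 : (2 ^ r)⁻¹ * N (x' - y) ^ r ≤ K ^ r + N (x - y) ^ r := by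
    rw [inv_mul_le_iff₀ (by positivity)]; exact h3
  linarith

lemma tsum_setLIntegral_floorVec (F : (Fin d → ℝ) → ℝ≥0∞) :
    ∑' i, ∫⁻ x in floorVec ⁻¹' {i}, F x = ∫⁻ x, F x := by
  rw [← lintegral_iUnion (fun i => measurable_floorVec (measurableSet_singleton i))]
  · rw [← Set.preimage_iUnion, Set.iUnion_of_singleton, Set.preimage_univ, Measure.restrict_univ]
  · exact fun i j hij => (Set.disjoint_singleton.2 hij).preimage _

/-- A channel with finite mutual information and finite distortion forces the integer part of the
source to have finite entropy. The Donsker–Varadhan inequality is applied with the test function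
`log (1 / p ⌊x⌋) - N(x - y) ^ r`, whose exponential moment is bounded, uniformly in `y`, by
comparing the value of `exp (-N(x - y) ^ r)` with an average over the unit cell of `x`. -/
lemma discreteEntropy_floorVec_ne_top (N : Seminorm ℝ (Fin d → ℝ)) (hN : ∀ x, N x = 0 → x = 0)
    {r : ℝ} (hr : 0 < r) {μ : Measure (Fin d → ℝ)} [IsProbabilityMeasure μ]
    (κ : Kernel (Fin d → ℝ) (Fin d → ℝ)) [IsMarkovKernel κ]
    (hdist : expectedDistortion N r (μ ⊗ₘ κ) ≠ ∞) (htop : mutualInfo (μ ⊗ₘ κ) ≠ ∞) :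
    discreteEntropy (μ.map floorVec) ≠ ∞ := by
  have hprob := Measure.isProbabilityMeasure_map (μ := μ) measurable_floorVec.aemeasurable
  set p : (Fin d → ℤ) → ℝ := fun i => (μ.map floorVec).real {i} with hp
  have hpm : Measurable fun x : Fin d → ℝ => p (floorVec x) :=
    (Measurable.of_discrete (f := p)).comp measurable_floorVec
  have ham : Measurable fun q : (Fin d → ℝ) × (Fin d → ℝ) => -Real.log (p (floorVec q.1)) :=
    hpm.log.neg.comp measurable_fst
  have hbm : Measurable fun q : (Fin d → ℝ) × (Fin d → ℝ) => N (q.1 - q.2) ^ r :=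
    (continuous_seminorm_rpow N hr).measurable.comp (measurable_fst.sub measurable_snd)
  set C : ℝ := Real.exp ((∑ i, N (Pi.single i 1)) ^ r)
  set J : ℝ≥0∞ := ∫⁻ x : Fin d → ℝ, ENNReal.ofReal (Real.exp (-((2 ^ r)⁻¹ * N x ^ r)))
  have hJtop : J ≠ ∞ :=
    (integrable_exp_neg_mul_rpow N hN hr (by positivity : (0 : ℝ) < (2 ^ r)⁻¹)).lintegral_lt_top.ne
  have h := lintegral_add_le_klDiv (ρ := μ ⊗ₘ κ) (σ := (μ ⊗ₘ κ).fst.prod (μ ⊗ₘ κ).snd)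
    (a := fun q => -Real.log (p (floorVec q.1))) (b := fun q => N (q.1 - q.2) ^ r)
    ham hbm
    (fun q => neg_nonneg.2 (Real.log_nonpos measureReal_nonneg measureReal_le_one))
    (fun q => Real.rpow_nonneg (apply_nonneg N _) r)
  have hent : ∫⁻ q, ENNReal.ofReal (-Real.log (p (floorVec q.1))) ∂(μ ⊗ₘ κ) =
      discreteEntropy (μ.map floorVec) := by
    rw [← lintegral_negLog_floorVec, Measure.lintegral_compProd ham.ennreal_ofReal]
    simp [hp]
  have hexp : ∫⁻ q, ENNReal.ofReal (Real.exp (-Real.log (p (floorVec q.1)) - N (q.1 - q.2) ^ r))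
      ∂((μ ⊗ₘ κ).fst.prod (μ ⊗ₘ κ).snd) ≤ ENNReal.ofReal C * J := by
    have hm : Measurable fun q : (Fin d → ℝ) × (Fin d → ℝ) =>
        ENNReal.ofReal (Real.exp (-Real.log (p (floorVec q.1)) - N (q.1 - q.2) ^ r)) :=
      (ham.sub hbm).exp.ennreal_ofReal
    rw [Measure.fst_compProd, lintegral_prod_symm _ hm.aemeasurable]
    calc _ ≤ ∫⁻ _, ENNReal.ofReal C * J ∂(μ ⊗ₘ κ).snd := lintegral_mono fun y => ?_
      _ = ENNReal.ofReal C * J := by simp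
    -- on the cell of `x`, the value at `x` is at most a constant times the average over the cell
    let G : (Fin d → ℤ) → ℝ≥0∞ := fun i =>
      ∫⁻ x in floorVec ⁻¹' {i}, ENNReal.ofReal (Real.exp (-((2 ^ r)⁻¹ * N (x - y) ^ r)))
    calc ∫⁻ x, ENNReal.ofReal (Real.exp (-Real.log (p (floorVec x)) - N (x - y) ^ r)) ∂μ
        ≤ ∫⁻ x, ENNReal.ofReal (Real.exp (-Real.log (p (floorVec x)))) *
            (ENNReal.ofReal C * G (floorVec x)) ∂μ := by
          refine lintegral_mono fun x => ?_
          rw [sub_eq_add_neg, Real.exp_add, ENNReal.ofReal_mul (Real.exp_pos _).le]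
          gcongr
          calc ENNReal.ofReal (Real.exp (-N (x - y) ^ r))
              = ∫⁻ _ in floorVec ⁻¹' {floorVec x}, ENNReal.ofReal (Real.exp (-N (x - y) ^ r)) := by
                rw [setLIntegral_const, volume_floorVec_preimage_singleton, mul_one]
            _ ≤ ∫⁻ x' in floorVec ⁻¹' {floorVec x},
                ENNReal.ofReal C * ENNReal.ofReal (Real.exp (-((2 ^ r)⁻¹ * N (x' - y) ^ r))) := by
                refine setLIntegral_mono' (measurable_floorVec (measurableSet_singleton _))
                  fun x' hx' => ?_
                rw [← ENNReal.ofReal_mul (Real.exp_pos _).le]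
                exact ENNReal.ofReal_le_ofReal (exp_neg_rpow_le_of_floorVec_eq N hr y hx')
            _ = ENNReal.ofReal C * G (floorVec x) := by
                refine lintegral_const_mul _ ?_
                exact ((hbm.comp (measurable_id.prodMk measurable_const)).const_mul
                  _).neg.exp.ennreal_ofReal
      _ = ∑' i, ENNReal.ofReal (Real.exp (-Real.log (p i))) * (ENNReal.ofReal C * G i) *
            μ.map floorVec {i} :=
          lintegral_comp_floorVec μ fun i =>
            ENNReal.ofReal (Real.exp (-Real.log (p i))) * (ENNReal.ofReal C * G i)
      _ ≤ ∑' i, ENNReal.ofReal C * G i := by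
          refine ENNReal.tsum_le_tsum fun i => ?_
          rw [mul_right_comm, ← ofReal_measureReal, ← ENNReal.ofReal_mul (Real.exp_pos _).le]
          refine mul_le_of_le_one_left' ?_
          rw [ENNReal.ofReal_le_one]
          change Real.exp (-Real.log (p i)) * p i ≤ 1
          have hpi : 0 ≤ p i := measureReal_nonneg
          rcases hpi.eq_or_lt with h0 | h0
          · rw [← h0]; simp
          · rw [Real.exp_neg, Real.exp_log h0, inv_mul_cancel₀ h0.ne']
      _ = ENNReal.ofReal C * J := by
          rw [ENNReal.tsum_mul_left, tsum_setLIntegral_floorVec]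
          rw [lintegral_sub_right_eq_self
            (fun x => ENNReal.ofReal (Real.exp (-((2 ^ r)⁻¹ * N x ^ r)))) y]
  rw [hent] at h
  refine ne_top_of_le_ne_top ?_ (le_self_add.trans h)
  refine ENNReal.add_ne_top.2 ⟨ENNReal.add_ne_top.2 ⟨htop, ?_⟩, hdist⟩
  exact ne_top_of_le_ne_top (ENNReal.mul_ne_top ENNReal.ofReal_ne_top hJtop) hexp

end InfiniteRate

/-! ### Exponential smoothing of the source law -/

section ExpSmoothing

variable {d : ℕ}

/-- The law `μ` smoothed by the kernel `exp (-N)`. It is an unnormalized density whose logarithm is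
`1`-Lipschitz for `N`. -/
noncomputable def expSmoothing (N : Seminorm ℝ (Fin d → ℝ)) (μ : Measure (Fin d → ℝ))
    (y : Fin d → ℝ) : ℝ := ∫ x, Real.exp (-N (y - x)) ∂μ

variable (N : Seminorm ℝ (Fin d → ℝ)) (μ : Measure (Fin d → ℝ)) [IsProbabilityMeasure μ]

lemma integrable_exp_neg_seminorm (y : Fin d → ℝ) :
    Integrable (fun x => Real.exp (-N (y - x))) μ := by
  have := continuous_seminorm N
  refine (integrable_const (1 : ℝ)).mono' (by fun_prop) (ae_of_all _ fun x => ?_)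
  rw [Real.norm_of_nonneg (Real.exp_pos _).le]
  exact Real.exp_le_one_iff.2 (neg_nonpos.2 (apply_nonneg N _))

lemma expSmoothing_pos (y : Fin d → ℝ) : 0 < expSmoothing N μ y :=
  integral_exp_pos (integrable_exp_neg_seminorm N μ y)

lemma expSmoothing_le_one (y : Fin d → ℝ) : expSmoothing N μ y ≤ 1 := by
  calc expSmoothing N μ y ≤ ∫ _, (1 : ℝ) ∂μ :=
        integral_mono (integrable_exp_neg_seminorm N μ y) (integrable_const _) fun x =>
          Real.exp_le_one_iff.2 (neg_nonpos.2 (apply_nonneg N _))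
    _ = 1 := by simp

lemma exp_neg_mul_expSmoothing_le (x y : Fin d → ℝ) :
    Real.exp (-N (y - x)) * expSmoothing N μ x ≤ expSmoothing N μ y := by
  unfold expSmoothing
  rw [← integral_const_mul]
  refine integral_mono ((integrable_exp_neg_seminorm N μ x).const_mul _)
    (integrable_exp_neg_seminorm N μ y) fun u => ?_
  simp only
  rw [← Real.exp_add, Real.exp_le_exp]
  have := map_add_le_add N (y - x) (x - u)
  rw [sub_add_sub_cancel] at this
  linarith

lemma log_expSmoothing_sub_le (x y : Fin d → ℝ) :
    Real.log (expSmoothing N μ x) - N (y - x) ≤ Real.log (expSmoothing N μ y) := by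
  have h := Real.log_le_log (mul_pos (Real.exp_pos _) (expSmoothing_pos N μ x))
    (exp_neg_mul_expSmoothing_le N μ x y)
  rw [Real.log_mul (Real.exp_pos _).ne' (expSmoothing_pos N μ x).ne', Real.log_exp] at h
  linarith

lemma continuous_expSmoothing : Continuous (expSmoothing N μ) := by
  have hlog : Continuous fun y => Real.log (expSmoothing N μ y) := by
    refine continuous_iff_continuousAt.2 fun x => ?_
    rw [ContinuousAt, tendsto_iff_dist_tendsto_zero]
    have hN : Tendsto (fun y => N (y - x)) (𝓝 x) (𝓝 0) := by
      have : Continuous fun y => N (y - x) :=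
        (continuous_seminorm N).comp (continuous_id.sub continuous_const)
      simpa using this.tendsto x
    refine squeeze_zero (fun _ => dist_nonneg) (fun y => ?_) hN
    have h1 := log_expSmoothing_sub_le N μ x y
    have h2 := log_expSmoothing_sub_le N μ y x
    rw [map_sub_rev N] at h2
    rw [Real.dist_eq, abs_le]
    constructor <;> linarith
  have : expSmoothing N μ = fun y => Real.exp (Real.log (expSmoothing N μ y)) :=
    funext fun y => (Real.exp_log (expSmoothing_pos N μ y)).symm
  rw [this]
  exact hlog.rexp

lemma integrable_expSmoothing (hN : ∀ x, N x = 0 → x = 0) : Integrable (expSmoothing N μ) := by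
  have hc := continuous_seminorm N
  refine ⟨(continuous_expSmoothing N μ).aestronglyMeasurable, ?_⟩
  rw [hasFiniteIntegral_iff_ofReal (ae_of_all _ fun y => (expSmoothing_pos N μ y).le)]
  have h1 : Integrable fun x : Fin d → ℝ => Real.exp (-N x) := by
    simpa using integrable_exp_neg_rpow N hN one_pos
  calc ∫⁻ y, ENNReal.ofReal (expSmoothing N μ y)
      = ∫⁻ y, ∫⁻ x, ENNReal.ofReal (Real.exp (-N (y - x))) ∂μ := by
        refine lintegral_congr fun y => ?_
        rw [expSmoothing, ofReal_integral_eq_lintegral_ofReal (integrable_exp_neg_seminorm N μ y)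
          (ae_of_all _ fun x => (Real.exp_pos _).le)]
    _ = ∫⁻ x, (∫⁻ y, ENNReal.ofReal (Real.exp (-N (y - x)))) ∂μ := by
        refine lintegral_lintegral_swap ?_
        have : Continuous fun p : (Fin d → ℝ) × (Fin d → ℝ) => Real.exp (-N (p.1 - p.2)) := by
          fun_prop
        exact this.measurable.ennreal_ofReal.aemeasurable
    _ = ∫⁻ _, (∫⁻ y : Fin d → ℝ, ENNReal.ofReal (Real.exp (-N y))) ∂μ :=
        lintegral_congr fun x =>
          lintegral_sub_right_eq_self (fun y => ENNReal.ofReal (Real.exp (-N y))) x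
    _ < ∞ := by
        simpa using h1.lintegral_lt_top

/-- Within a unit cell the kernel `exp (-N)` is bounded below, so the smoothed density dominates
the probability of the cell. This is where the finite entropy of the integer part enters. -/
lemma integrable_log_expSmoothing (h : discreteEntropy (μ.map floorVec) ≠ ∞) :
    Integrable (fun x => Real.log (expSmoothing N μ x)) μ := by
  set K := ∑ i, N (Pi.single i 1) with hK
  have hlow : ∀ x, Real.exp (-K) * (μ.map floorVec).real {floorVec x} ≤ expSmoothing N μ x := by
    intro x
    have hmeas : MeasurableSet (floorVec ⁻¹' {floorVec x} : Set (Fin d → ℝ)) :=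
      measurable_floorVec (measurableSet_singleton _)
    rw [measureReal_def, Measure.map_apply measurable_floorVec (measurableSet_singleton _),
      ← measureReal_def, mul_comm, ← smul_eq_mul, ← setIntegral_const]
    calc ∫ _ in floorVec ⁻¹' {floorVec x}, Real.exp (-K) ∂μ
        ≤ ∫ u in floorVec ⁻¹' {floorVec x}, Real.exp (-N (x - u)) ∂μ := by
          refine setIntegral_mono_on (integrable_const _).integrableOn
            (integrable_exp_neg_seminorm N μ x).integrableOn hmeas fun u hu => ?_
          exact Real.exp_le_exp.2 (neg_le_neg (seminorm_sub_le_of_floorVec_eq N hu.symm))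
      _ ≤ expSmoothing N μ x :=
          setIntegral_le_integral (integrable_exp_neg_seminorm N μ x)
            (ae_of_all _ fun u => (Real.exp_pos _).le)
  have hlog : ∀ x, -Real.log (expSmoothing N μ x) ≤
      K + -Real.log ((μ.map floorVec).real {floorVec x}) ∨
      (μ.map floorVec).real {floorVec x} = 0 := by
    intro x
    rcases (measureReal_nonneg : 0 ≤ (μ.map floorVec).real {floorVec x}).eq_or_lt with h0 | h0
    · exact Or.inr h0.symm
    · left
      have := Real.log_le_log (mul_pos (Real.exp_pos _) h0) (hlow x)
      rw [Real.log_mul (Real.exp_pos _).ne' h0.ne', Real.log_exp] at this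
      linarith
  have hnull : ∀ᵐ x ∂μ, (μ.map floorVec).real {floorVec x} ≠ 0 := by
    have h1 : ∀ᵐ i ∂(μ.map floorVec), (μ.map floorVec).real {i} ≠ 0 := by
      rw [ae_iff_of_countable]
      intro i hi
      have := Measure.isProbabilityMeasure_map (μ := μ) measurable_floorVec.aemeasurable
      exact (measureReal_ne_zero_iff (measure_ne_top _ _)).2 hi
    exact ae_of_ae_map measurable_floorVec.aemeasurable h1
  refine ⟨(continuous_expSmoothing N μ).measurable.log.aestronglyMeasurable, ?_⟩
  have hneg : ∀ x, Real.log (expSmoothing N μ x) ≤ 0 := fun x =>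
    Real.log_nonpos (expSmoothing_pos N μ x).le (expSmoothing_le_one N μ x)
  have hK0 : 0 ≤ K := Finset.sum_nonneg fun i _ => apply_nonneg N _
  rw [hasFiniteIntegral_iff_norm]
  calc ∫⁻ x, ENNReal.ofReal ‖Real.log (expSmoothing N μ x)‖ ∂μ
      ≤ ∫⁻ x, (ENNReal.ofReal K +
          ENNReal.ofReal (-Real.log ((μ.map floorVec).real {floorVec x}))) ∂μ := by
        refine lintegral_mono_ae ?_
        filter_upwards [hnull] with x hx
        rw [Real.norm_of_nonpos (hneg x)]
        exact (ENNReal.ofReal_le_ofReal ((hlog x).resolve_right hx)).trans ENNReal.ofReal_add_le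
    _ = ENNReal.ofReal K + discreteEntropy (μ.map floorVec) := by
        rw [lintegral_add_left measurable_const, lintegral_negLog_floorVec]
        simp
    _ < ∞ := ENNReal.add_lt_top.2 ⟨ENNReal.ofReal_lt_top, h.lt_top⟩

end ExpSmoothing

/-! ### The maximum entropy noise and its scaling -/

section GibbsMeasure

variable {d : ℕ}

/-- The probability measure with density `gibbsDensity N r s`. -/
noncomputable def gibbsMeasure (N : Seminorm ℝ (Fin d → ℝ)) (r s : ℝ) : Measure (Fin d → ℝ) :=
  volume.withDensity fun z => ENNReal.ofReal (gibbsDensity N r s z)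

variable (N : Seminorm ℝ (Fin d → ℝ)) {r s : ℝ}

lemma lintegral_gibbsMeasure (hr : 0 < r) {F : (Fin d → ℝ) → ℝ≥0∞} (hF : Measurable F) :
    ∫⁻ z, F z ∂gibbsMeasure N r s = ∫⁻ z, ENNReal.ofReal (gibbsDensity N r s z) * F z := by
  rw [gibbsMeasure, lintegral_withDensity_eq_lintegral_mul _
    (measurable_gibbsDensity N hr s).ennreal_ofReal hF]
  rfl

variable (hN : ∀ x, N x = 0 → x = 0) (hd : 1 ≤ d) (hr : 0 < r) (hs : 0 < s)
include hN hd hr hs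

lemma isProbabilityMeasure_gibbsMeasure : IsProbabilityMeasure (gibbsMeasure N r s) :=
  ⟨by rw [gibbsMeasure, withDensity_apply _ MeasurableSet.univ, Measure.restrict_univ,
    lintegral_gibbsDensity N hN hd hr hs]⟩

lemma integrable_gibbsMeasure_iff {F : (Fin d → ℝ) → ℝ} :
    Integrable F (gibbsMeasure N r s) ↔ Integrable fun z => F z * gibbsDensity N r s z := by
  rw [gibbsMeasure, integrable_withDensity_iff (measurable_gibbsDensity N hr s).ennreal_ofReal
    (ae_of_all _ fun _ => ENNReal.ofReal_lt_top)]
  simp_rw [ENNReal.toReal_ofReal (gibbsDensity_pos N hN hd hr hs _).le]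

lemma integral_gibbsMeasure (F : (Fin d → ℝ) → ℝ) :
    ∫ z, F z ∂gibbsMeasure N r s = ∫ z, F z * gibbsDensity N r s z := by
  rw [gibbsMeasure, integral_withDensity_eq_integral_toReal_smul
    (measurable_gibbsDensity N hr s).ennreal_ofReal (ae_of_all _ fun _ => ENNReal.ofReal_lt_top)]
  simp_rw [ENNReal.toReal_ofReal (gibbsDensity_pos N hN hd hr hs _).le, smul_eq_mul, mul_comm]

lemma integrable_rpow_gibbsMeasure : Integrable (fun z => N z ^ r) (gibbsMeasure N r s) :=
  (integrable_gibbsMeasure_iff N hN hd hr hs).2 (integrable_rpow_mul_gibbsDensity N hN hr hs)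

lemma integral_rpow_gibbsMeasure : ∫ z, N z ^ r ∂gibbsMeasure N r s = d / r / s := by
  rw [integral_gibbsMeasure N hN hd hr hs, integral_rpow_mul_gibbsDensity N hN hd hr hs]

/-- For `r < 1` the first moment is not controlled by the `r`-th one, but the stretched-exponential
decay of the density still dominates every polynomial. -/
lemma integrable_seminorm_gibbsMeasure : Integrable (fun z => N z) (gibbsMeasure N r s) := by
  obtain ⟨n, hn⟩ := exists_nat_gt (1 / r)
  have hrn : 1 ≤ r * n := by
    rw [div_lt_iff₀ hr] at hn; linarith
  set Z := ∫ z : Fin d → ℝ, Real.exp (-(s * N z ^ r))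
  have hZ : 0 < Z := integral_exp_neg_mul_rpow_pos N hN hd hr hs
  rw [integrable_gibbsMeasure_iff N hN hd hr hs]
  have hdom := ((integrable_exp_neg_mul_rpow N hN hr hs).add
    ((integrable_exp_neg_mul_rpow N hN hr (half_pos hs)).const_mul
      (n.factorial * (2 / s) ^ n))).div_const Z
  refine hdom.mono' ((measurable_seminorm N).mul
    (measurable_gibbsDensity N hr s)).aestronglyMeasurable (ae_of_all _ fun z => ?_)
  have h0 := apply_nonneg N z
  have ht : 0 ≤ N z ^ r := Real.rpow_nonneg h0 r
  rw [Real.norm_of_nonneg (mul_nonneg h0 (gibbsDensity_pos N hN hd hr hs z).le), gibbsDensity,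
    mul_div_assoc']
  refine div_le_div_of_nonneg_right ?_ hZ.le
  have h1 : N z ≤ 1 + (N z ^ r) ^ n := by
    rcases le_total (N z) 1 with h | h
    · linarith [pow_nonneg ht n]
    · rw [← Real.rpow_natCast, ← Real.rpow_mul h0]
      linarith [Real.self_le_rpow_of_one_le h hrn]
  have h2 : (N z ^ r) ^ n ≤ n.factorial * (2 / s) ^ n * Real.exp (s / 2 * N z ^ r) := by
    have := Real.pow_div_factorial_le_exp (s / 2 * N z ^ r) (by positivity) n
    rw [div_le_iff₀ (by positivity)] at this
    calc (N z ^ r) ^ n = (2 / s) ^ n * (s / 2 * N z ^ r) ^ n := by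
          rw [← mul_pow]; congr 1; field_simp
      _ ≤ (2 / s) ^ n * (Real.exp (s / 2 * N z ^ r) * n.factorial) := by gcongr
      _ = _ := by ring
  have h3 : Real.exp (s / 2 * N z ^ r) * Real.exp (-(s * N z ^ r)) =
      Real.exp (-(s / 2 * N z ^ r)) := by
    rw [← Real.exp_add]; ring_nf
  simp only [Pi.add_apply]
  calc N z * Real.exp (-(s * N z ^ r))
      ≤ (1 + n.factorial * (2 / s) ^ n * Real.exp (s / 2 * N z ^ r)) *
          Real.exp (-(s * N z ^ r)) := by
        gcongr; linarith
    _ = _ := by rw [add_mul, one_mul, mul_assoc _ (Real.exp _) (Real.exp _), h3]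

lemma gibbsDensity_smul {ε : ℝ} (hε : 0 < ε) (z : Fin d → ℝ) :
    ε ^ d * gibbsDensity N r (s / ε ^ r) (ε • z) = gibbsDensity N r s z := by
  have hεr : 0 < ε ^ r := Real.rpow_pos_of_pos hε r
  have hA := unitBallVolume_mul_Gamma_pos N hN hd hr
  have h1 : s / ε ^ r * N (ε • z) ^ r = s * N z ^ r := by
    rw [map_smul_eq_mul, Real.norm_of_nonneg hε.le, Real.mul_rpow hε.le (apply_nonneg N z)]
    field_simp
  have h2 : (s / ε ^ r) ^ (-(d / r : ℝ)) = s ^ (-(d / r : ℝ)) * ε ^ d := by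
    rw [Real.div_rpow hs.le hεr.le, ← Real.rpow_mul hε.le,
      show r * -(d / r : ℝ) = -(d : ℝ) by field_simp, Real.rpow_neg hε.le, Real.rpow_natCast,
      div_inv_eq_mul]
  rw [gibbsDensity, gibbsDensity, h1, integral_exp_neg_mul_rpow N hN hd hr hs,
    integral_exp_neg_mul_rpow N hN hd hr (div_pos hs hεr), h2]
  have := Real.rpow_pos_of_pos hs (-(d / r : ℝ))
  field_simp

lemma map_smul_gibbsMeasure {ε : ℝ} (hε : 0 < ε) :
    (gibbsMeasure N r s).map (ε • ·) = gibbsMeasure N r (s / ε ^ r) := by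
  have hsm : Measurable fun z : Fin d → ℝ => ε • z := measurable_const_smul ε
  refine Measure.ext_of_lintegral _ fun F hF => ?_
  have hG := (measurable_gibbsDensity N hr (s / ε ^ r)).ennreal_ofReal
  have hvol : ∀ H : (Fin d → ℝ) → ℝ≥0∞, Measurable H →
      ∫⁻ z, H (ε • z) = ENNReal.ofReal (ε ^ d)⁻¹ * ∫⁻ z, H z := by
    intro H hH
    rw [← lintegral_map hH hsm, Measure.map_addHaar_smul volume hε.ne', lintegral_smul_measure,
      Module.finrank_fin_fun, abs_of_nonneg (by positivity), smul_eq_mul]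
  have hFs : Measurable fun z => F (ε • z) := hF.comp hsm
  rw [lintegral_map hF hsm, lintegral_gibbsMeasure N hr hFs,
    lintegral_gibbsMeasure N hr hF]
  calc ∫⁻ z, ENNReal.ofReal (gibbsDensity N r s z) * F (ε • z)
      = ∫⁻ z, ENNReal.ofReal (ε ^ d) *
          (ENNReal.ofReal (gibbsDensity N r (s / ε ^ r) (ε • z)) * F (ε • z)) := by
        refine lintegral_congr fun z => ?_
        rw [← gibbsDensity_smul N hN hd hr hs hε, ENNReal.ofReal_mul (by positivity), mul_assoc]
    _ = ∫⁻ z, ENNReal.ofReal (gibbsDensity N r (s / ε ^ r) z) * F z := by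
        have hGF : Measurable fun z =>
            ENNReal.ofReal (gibbsDensity N r (s / ε ^ r) (ε • z)) * F (ε • z) :=
          (hG.comp hsm).mul hFs
        rw [lintegral_const_mul _ hGF, hvol
            (fun z => ENNReal.ofReal (gibbsDensity N r (s / ε ^ r) z) * F z) (hG.mul hF),
          ← mul_assoc, ← ENNReal.ofReal_mul (by positivity), mul_inv_cancel₀ (by positivity),
          ENNReal.ofReal_one, one_mul]

end GibbsMeasure

/-! ### The additive noise channel -/

section AdditiveNoise

open InformationTheory

variable {d : ℕ}

/-- The channel that adds to its input an independent noise vector with law `γ`. -/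
noncomputable def additiveNoise (γ : Measure (Fin d → ℝ)) :
    Kernel (Fin d → ℝ) (Fin d → ℝ) :=
  (Kernel.id ×ₖ Kernel.const (Fin d → ℝ) γ).map fun p => p.1 + p.2

lemma isMarkovKernel_additiveNoise (γ : Measure (Fin d → ℝ)) [IsProbabilityMeasure γ] :
    IsMarkovKernel (additiveNoise γ) :=
  Kernel.IsMarkovKernel.map _ (measurable_fst.add measurable_snd)

lemma measurable_shear :
    Measurable fun p : (Fin d → ℝ) × (Fin d → ℝ) => (p.1, p.1 + p.2) :=
  measurable_fst.prodMk (measurable_fst.add measurable_snd)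

lemma compProd_additiveNoise (μ γ : Measure (Fin d → ℝ)) [IsProbabilityMeasure μ]
    [IsProbabilityMeasure γ] :
    μ ⊗ₘ additiveNoise γ = (μ.prod γ).map fun p => (p.1, p.1 + p.2) := by
  have := isMarkovKernel_additiveNoise γ
  refine Measure.ext_of_lintegral _ fun F hF => ?_
  have hadd : Measurable fun p : (Fin d → ℝ) × (Fin d → ℝ) => p.1 + p.2 :=
    measurable_fst.add measurable_snd
  have hFs : Measurable fun p : (Fin d → ℝ) × (Fin d → ℝ) => F (p.1, p.1 + p.2) :=
    hF.comp measurable_shear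
  rw [lintegral_map hF measurable_shear, Measure.lintegral_compProd hF,
    lintegral_prod _ hFs.aemeasurable]
  refine lintegral_congr fun x => ?_
  have hFx : Measurable fun y => F (x, y) := hF.comp measurable_prodMk_left
  have hFxa : Measurable fun p : (Fin d → ℝ) × (Fin d → ℝ) => F (x, p.1 + p.2) := hFx.comp hadd
  rw [additiveNoise, Kernel.map_apply _ hadd, lintegral_map hFx hadd, Kernel.prod_apply,
    Kernel.id_apply, Kernel.const_apply, lintegral_prod _ hFxa.aemeasurable,
    lintegral_dirac' _ hFxa.lintegral_prod_right']

variable (N : Seminorm ℝ (Fin d → ℝ)) (hN : ∀ x, N x = 0 → x = 0) (hd : 1 ≤ d)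
  {r s : ℝ} (hr : 0 < r) (hs : 0 < s)
include hN hd hr hs

lemma expectedDistortion_additiveNoise (μ : Measure (Fin d → ℝ)) [IsProbabilityMeasure μ] :
    expectedDistortion N r (μ ⊗ₘ additiveNoise (gibbsMeasure N r s)) =
      ENNReal.ofReal (d / r / s) := by
  have := isProbabilityMeasure_gibbsMeasure N hN hd hr hs
  have hm : Measurable fun z => ENNReal.ofReal (N z ^ r) :=
    (continuous_seminorm_rpow N hr).measurable.ennreal_ofReal
  have hm' : Measurable fun p : (Fin d → ℝ) × (Fin d → ℝ) =>
      ENNReal.ofReal (N (p.1 - p.2) ^ r) := hm.comp (measurable_fst.sub measurable_snd)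
  have hm2 : Measurable fun p : (Fin d → ℝ) × (Fin d → ℝ) => ENNReal.ofReal (N p.2 ^ r) :=
    hm.comp measurable_snd
  rw [expectedDistortion, compProd_additiveNoise, lintegral_map hm' measurable_shear]
  have heq : ∀ p : (Fin d → ℝ) × (Fin d → ℝ), N (p.1 - (p.1 + p.2)) = N p.2 := fun p => by
    rw [sub_add_cancel_left, map_neg_eq_map]
  simp_rw [heq]
  rw [lintegral_prod _ hm2.aemeasurable]
  simp only [lintegral_const, measure_univ, mul_one]
  rw [← ofReal_integral_eq_lintegral_ofReal (integrable_rpow_gibbsMeasure N hN hd hr hs)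
    (ae_of_all _ fun z => Real.rpow_nonneg (apply_nonneg N z) r),
    integral_rpow_gibbsMeasure N hN hd hr hs]

/-- The joint law of the input and the output of the channel has an explicit density with respect to
`μ × Q` whenever `Q` has a positive density `q`. -/
lemma compProd_additiveNoise_eq_withDensity (μ : Measure (Fin d → ℝ)) [IsProbabilityMeasure μ]
    {q : (Fin d → ℝ) → ℝ} (hq : Measurable q) (hq0 : ∀ y, 0 < q y) :
    μ ⊗ₘ additiveNoise (gibbsMeasure N r s) =
      (μ.prod (volume.withDensity fun y => ENNReal.ofReal (q y))).withDensity
        fun p => ENNReal.ofReal (gibbsDensity N r s (p.2 - p.1) / q p.2) := by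
  have := isProbabilityMeasure_gibbsMeasure N hN hd hr hs
  have hGm := measurable_gibbsDensity N hr s
  have hρm : Measurable fun p : (Fin d → ℝ) × (Fin d → ℝ) =>
      ENNReal.ofReal (gibbsDensity N r s (p.2 - p.1) / q p.2) := by fun_prop
  refine Measure.ext_of_lintegral _ fun F hF => ?_
  have hFs : Measurable fun p : (Fin d → ℝ) × (Fin d → ℝ) => F (p.1, p.1 + p.2) :=
    hF.comp measurable_shear
  rw [compProd_additiveNoise, lintegral_map hF measurable_shear,
    lintegral_prod _ hFs.aemeasurable,
    lintegral_withDensity_eq_lintegral_mul _ hρm hF, lintegral_prod _ (hρm.mul hF).aemeasurable]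
  refine lintegral_congr fun x => ?_
  have hFx : Measurable fun y => F (x, y) := hF.comp measurable_prodMk_left
  have hFxa : Measurable fun z => F (x, x + z) := hFx.comp (measurable_const_add x)
  have hGF : Measurable fun y =>
      ENNReal.ofReal (gibbsDensity N r s (y - x) / q y) * F (x, y) := by fun_prop
  calc ∫⁻ z, F (x, x + z) ∂gibbsMeasure N r s
      = ∫⁻ z, ENNReal.ofReal (gibbsDensity N r s z) * F (x, x + z) :=
        lintegral_gibbsMeasure N hr hFxa
    _ = ∫⁻ y, ENNReal.ofReal (gibbsDensity N r s (y - x)) * F (x, y) := by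
        rw [← lintegral_sub_right_eq_self
          (fun z => ENNReal.ofReal (gibbsDensity N r s z) * F (x, x + z)) x]
        simp only [add_sub_cancel]
    _ = ∫⁻ y, ENNReal.ofReal (q y) *
          (ENNReal.ofReal (gibbsDensity N r s (y - x) / q y) * F (x, y)) := by
        refine lintegral_congr fun y => ?_
        rw [← mul_assoc, ← ENNReal.ofReal_mul (hq0 y).le, mul_div_cancel₀ _ (hq0 y).ne']
    _ = ∫⁻ y, ENNReal.ofReal (gibbsDensity N r s (y - x) / q y) * F (x, y)
          ∂(volume.withDensity fun y => ENNReal.ofReal (q y)) :=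
        (lintegral_withDensity_eq_lintegral_mul _ hq.ennreal_ofReal hGF).symm

/-- The mutual information of the additive Gibbs channel, bounded with the help of an arbitrary
positive output density `q`, which need not be normalized. -/
lemma toReal_mutualInfo_additiveNoise_le (μ : Measure (Fin d → ℝ)) [IsProbabilityMeasure μ]
    {q : (Fin d → ℝ) → ℝ} (hq : Measurable q) (hq0 : ∀ y, 0 < q y) (hqi : Integrable q)
    (hlog : Integrable (fun p : (Fin d → ℝ) × (Fin d → ℝ) => Real.log (q (p.1 + p.2)))
      (μ.prod (gibbsMeasure N r s))) :
    mutualInfo (μ ⊗ₘ additiveNoise (gibbsMeasure N r s)) ≠ ∞ ∧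
    (mutualInfo (μ ⊗ₘ additiveNoise (gibbsMeasure N r s))).toReal ≤
      (d / r * Real.log s - Real.log (unitBallVolume N * Real.Gamma (1 + d / r))) - d / r
        - ∫ p, Real.log (q (p.1 + p.2)) ∂(μ.prod (gibbsMeasure N r s)) + (∫ y, q y) - 1 := by
  have hγ := isProbabilityMeasure_gibbsMeasure N hN hd hr hs
  have hκ := isMarkovKernel_additiveNoise (gibbsMeasure N r s)
  have hGm := measurable_gibbsDensity N hr s
  set γ := gibbsMeasure N r s
  set ρ := μ ⊗ₘ additiveNoise γ with hρ
  set Q : Measure (Fin d → ℝ) := volume.withDensity fun y => ENNReal.ofReal (q y) with hQ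
  set A := d / r * Real.log s - Real.log (unitBallVolume N * Real.Gamma (1 + d / r)) with hA
  have hQfin : IsFiniteMeasure Q := isFiniteMeasure_withDensity_ofReal hqi.2
  have hQuniv : Q.real Set.univ = ∫ y, q y := by
    rw [measureReal_def, hQ, withDensity_apply _ MeasurableSet.univ, Measure.restrict_univ,
      ← ofReal_integral_eq_lintegral_ofReal hqi (ae_of_all _ fun y => (hq0 y).le),
      ENNReal.toReal_ofReal (integral_nonneg fun y => (hq0 y).le)]
  have hdens := compProd_additiveNoise_eq_withDensity N hN hd hr hs μ hq hq0
  have hac : ρ ≪ μ.prod Q := by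
    rw [hρ, hdens]; exact withDensity_absolutelyContinuous _ _
  have hllr : llr ρ (μ.prod Q) =ᵐ[ρ] fun p =>
      (-(s * N (p.2 - p.1) ^ r) + A) - Real.log (q p.2) := by
    have h1 : ρ.rnDeriv (μ.prod Q) =ᵐ[μ.prod Q]
        fun p => ENNReal.ofReal (gibbsDensity N r s (p.2 - p.1) / q p.2) := by
      rw [hρ, hdens]
      exact Measure.rnDeriv_withDensity _ (by fun_prop)
    filter_upwards [hac.ae_le h1] with p hp
    have hg := gibbsDensity_pos N hN hd hr hs (p.2 - p.1)
    rw [llr, hp, ENNReal.toReal_ofReal (div_pos hg (hq0 _)).le, Real.log_div hg.ne' (hq0 _).ne',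
      log_gibbsDensity N hN hd hr hs]
  let φ : (Fin d → ℝ) × (Fin d → ℝ) → ℝ := fun p =>
    (-(s * N (p.2 - p.1) ^ r) + A) - Real.log (q p.2)
  have hNm := (continuous_seminorm_rpow N hr).measurable
  have hφm : Measurable φ :=
    (((hNm.comp (measurable_snd.sub measurable_fst)).const_mul s).neg.add_const A).sub
      (hq.comp measurable_snd).log
  have hφ : ∀ p : (Fin d → ℝ) × (Fin d → ℝ), φ (p.1, p.1 + p.2) =
      (-(s * N p.2 ^ r) + A) - Real.log (q (p.1 + p.2)) := fun p => by
    simp only [φ, add_sub_cancel_left]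
  have hNi : Integrable (fun p : (Fin d → ℝ) × (Fin d → ℝ) => N p.2 ^ r) (μ.prod γ) :=
    (integrable_rpow_gibbsMeasure N hN hd hr hs).comp_snd μ
  have hNi' : Integrable (fun p : (Fin d → ℝ) × (Fin d → ℝ) => -(s * N p.2 ^ r) + A)
      (μ.prod γ) := (hNi.const_mul s).neg.add (integrable_const A)
  have hφi : Integrable φ ρ := by
    rw [hρ, compProd_additiveNoise, integrable_map_measure hφm.aestronglyMeasurable
      measurable_shear.aemeasurable]
    exact (hNi'.sub hlog).congr (ae_of_all _ fun p => (hφ p).symm)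
  have hNval : ∫ p, N p.2 ^ r ∂(μ.prod γ) = d / r / s := by
    rw [integral_fun_snd (fun z => N z ^ r), integral_rpow_gibbsMeasure N hN hd hr hs]
    simp
  have hφval : ∫ p, φ p ∂ρ = A - d / r - ∫ p, Real.log (q (p.1 + p.2)) ∂(μ.prod γ) := by
    rw [hρ, compProd_additiveNoise, integral_map measurable_shear.aemeasurable
      hφm.aestronglyMeasurable]
    calc ∫ p, φ (p.1, p.1 + p.2) ∂(μ.prod γ)
        = ∫ p, (-(s * N p.2 ^ r) + A) - Real.log (q (p.1 + p.2)) ∂(μ.prod γ) := by simp_rw [hφ]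
      _ = ∫ p, (-(s * N p.2 ^ r) + A) ∂(μ.prod γ)
          - ∫ p, Real.log (q (p.1 + p.2)) ∂(μ.prod γ) := integral_sub hNi' hlog
      _ = (∫ p, -(s * N p.2 ^ r) ∂(μ.prod γ) + ∫ _, A ∂(μ.prod γ))
          - ∫ p, Real.log (q (p.1 + p.2)) ∂(μ.prod γ) :=
          congrArg (· - _) (integral_add (hNi.const_mul s).neg (integrable_const A))
      _ = _ := by
          rw [integral_neg, integral_const_mul, hNval, mul_div_cancel₀ _ hs.ne']
          simp
          ring
  have hint : Integrable (llr ρ (μ.prod Q)) ρ := hφi.congr hllr.symm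
  have hfst : ρ.fst = μ := Measure.fst_compProd μ _
  have hle : mutualInfo ρ ≤ klDiv ρ (μ.prod Q) := by
    have := mutualInfo_le_klDiv_prod ρ Q
    rwa [hfst] at this
  have htop := klDiv_ne_top hac hint
  refine ⟨ne_top_of_le_ne_top htop hle, (ENNReal.toReal_mono htop hle).trans_eq ?_⟩
  rw [toReal_klDiv hac hint, integral_congr_ae hllr]
  change ∫ p, φ p ∂ρ + _ - _ = _
  rw [hφval, ← hQuniv]
  have hρ1 : ρ.real Set.univ = 1 := by simp [hρ]
  have hprod : (μ.prod Q).real Set.univ = Q.real Set.univ := by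
    rw [← Set.univ_prod_univ, measureReal_prod_prod]; simp
  rw [hρ1, hprod]

end AdditiveNoise

/-! ### Choice of the output density -/

section OutputDensity

variable {d : ℕ} (N : Seminorm ℝ (Fin d → ℝ)) (hN : ∀ x, N x = 0 → x = 0)

lemma abs_log_le_of_expSmoothing_le (μ : Measure (Fin d → ℝ)) [IsProbabilityMeasure μ]
    {δ B t : ℝ} (hδ : 0 < δ) (x z : Fin d → ℝ)
    (hlow : δ * expSmoothing N μ (x + z) ≤ t) (hup : t ≤ B) :
    |Real.log t| ≤ |Real.log B| + |Real.log δ| + |Real.log (expSmoothing N μ x)| + N z := by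
  have hw := expSmoothing_pos N μ (x + z)
  have ht : 0 < t := (mul_pos hδ hw).trans_le hlow
  have h1 : Real.log t ≤ Real.log B := Real.log_le_log ht hup
  have h2 : Real.log δ + Real.log (expSmoothing N μ (x + z)) ≤ Real.log t := by
    rw [← Real.log_mul hδ.ne' hw.ne']
    exact Real.log_le_log (mul_pos hδ hw) hlow
  have h3 := log_expSmoothing_sub_le N μ x (x + z)
  rw [add_sub_cancel_left] at h3
  have hz := apply_nonneg N z
  rw [abs_le]
  constructor
  · linarith [abs_nonneg (Real.log B), neg_abs_le (Real.log δ),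
      neg_abs_le (Real.log (expSmoothing N μ x))]
  · linarith [le_abs_self (Real.log B), abs_nonneg (Real.log δ),
      abs_nonneg (Real.log (expSmoothing N μ x))]

include hN

/-- The density `f` is approximated by continuous bounded `q` that dominate a multiple of the
smoothed law, with a small excess of the cross entropy of `q` over the entropy of `f` and a small
excess of mass. The term `δ * expSmoothing N μ` provides the integrable bound for the logarithms
when continuous compactly supported `g` tend to `f` almost everywhere. -/
lemma exists_continuous_output_density {μ : Measure (Fin d → ℝ)} [IsProbabilityMeasure μ]
    {f : (Fin d → ℝ) → ℝ} (hf : Measurable f) (hf0 : ∀ x, 0 ≤ f x)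
    (hμ : μ = volume.withDensity fun x => ENNReal.ofReal (f x))
    (hlog : Integrable (fun x => Real.log (f x)) μ)
    (hw : Integrable (fun x => Real.log (expSmoothing N μ x)) μ) {η : ℝ} (hη : 0 < η) :
    ∃ q : (Fin d → ℝ) → ℝ, ∃ δ B : ℝ, Continuous q ∧ 0 < δ ∧
      (∀ y, δ * expSmoothing N μ y ≤ q y) ∧ (∀ y, q y ≤ B) ∧ Integrable q ∧
      (∫ y, q y) ≤ 1 + η ∧ -∫ x, Real.log (q x) ∂μ ≤ -∫ x, Real.log (f x) ∂μ + η := by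
  set w := expSmoothing N μ with hw_def
  have hwc : Continuous w := continuous_expSmoothing N μ
  have hw0 : ∀ y, 0 < w y := expSmoothing_pos N μ
  have hw1 : ∀ y, w y ≤ 1 := expSmoothing_le_one N μ
  have hwi : Integrable w := integrable_expSmoothing N μ hN
  have hlint : ∫⁻ x, ENNReal.ofReal (f x) = 1 := by
    have : μ Set.univ = 1 := measure_univ
    rwa [hμ, withDensity_apply _ MeasurableSet.univ, Measure.restrict_univ] at this
  have hfi : Integrable f := by
    refine ⟨hf.aestronglyMeasurable, ?_⟩
    rw [hasFiniteIntegral_iff_ofReal (ae_of_all _ hf0), hlint]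
    exact ENNReal.one_lt_top
  have hf1 : ∫ x, f x = 1 := by
    rw [integral_eq_lintegral_of_nonneg_ae (ae_of_all _ hf0) hf.aestronglyMeasurable, hlint,
      ENNReal.toReal_one]
  have hac : μ ≪ volume := by rw [hμ]; exact withDensity_absolutelyContinuous _ _
  have hfpos : ∀ᵐ x ∂μ, 0 < f x := by
    rw [hμ, ae_withDensity_iff hf.ennreal_ofReal]
    refine ae_of_all _ fun x hx => ?_
    simpa using hx
  -- continuous compactly supported approximations in `L¹`, made nonnegative
  have happ : ∀ n : ℕ, ∃ g : (Fin d → ℝ) → ℝ, Continuous g ∧ (∀ x, 0 ≤ g x) ∧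
      (∃ B, ∀ x, g x ≤ B) ∧ Integrable g ∧ ∫⁻ x, ‖f x - g x‖ₑ ≤ ENNReal.ofReal (1 / (n + 1)) := by
    intro n
    obtain ⟨g, hgs, hgle, hgc, hgi⟩ :=
      hfi.exists_hasCompactSupport_lintegral_sub_le (ε := ENNReal.ofReal (1 / (n + 1)))
        (by simp; positivity)
    obtain ⟨B, hB⟩ := hgs.exists_bound_of_continuous hgc
    refine ⟨fun x => max (g x) 0, hgc.max continuous_const, fun x => le_max_right _ _,
      ⟨B, fun x => max_le ((le_abs_self _).trans (hB x)) ((norm_nonneg _).trans (hB x))⟩,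
      hgi.pos_part, (lintegral_mono fun x => ?_).trans hgle⟩
    rw [Real.enorm_eq_ofReal_abs, Real.enorm_eq_ofReal_abs]
    refine ENNReal.ofReal_le_ofReal ?_
    have := abs_max_sub_max_le_abs (f x) (g x) 0
    rwa [max_eq_left (hf0 x)] at this
  choose g hgc hg0 hgB hgi hgle using happ
  have hlim0 : Tendsto (fun n : ℕ => ENNReal.ofReal (1 / (n + 1))) atTop (𝓝 0) := by
    have := ENNReal.tendsto_ofReal (tendsto_one_div_add_atTop_nhds_zero_nat (𝕜 := ℝ))
    simpa using this
  have hL1 : Tendsto (fun n => ∫⁻ x, ‖g n x - f x‖ₑ) atTop (𝓝 0) := by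
    refine tendsto_of_tendsto_of_tendsto_of_le_of_le tendsto_const_nhds hlim0
      (fun _ => zero_le) fun n => ?_
    refine le_trans (le_of_eq (lintegral_congr fun x => ?_)) (hgle n)
    rw [← enorm_neg, neg_sub]
  have hmass : Tendsto (fun n => ∫ x, g n x) atTop (𝓝 1) :=
    hf1 ▸ tendsto_integral_of_L1 f hfi.1 (Eventually.of_forall hgi) hL1
  have hmeas : TendstoInMeasure volume g atTop f := by
    refine tendstoInMeasure_of_tendsto_eLpNorm one_ne_zero
      (fun n => (hgc n).aestronglyMeasurable) hf.aestronglyMeasurable ?_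
    simpa [eLpNorm_one_eq_lintegral_enorm] using hL1
  obtain ⟨ns, hns, hae⟩ := hmeas.exists_seq_tendsto_ae
  set c := ∫ y, w y with hc
  have hc0 : 0 ≤ c := integral_nonneg fun y => (hw0 y).le
  set δ := η / 2 / (c + 1) with hδ_def
  have hδ : 0 < δ := by positivity
  have hδc : δ * c ≤ η / 2 := by
    rw [hδ_def, div_mul_eq_mul_div, div_le_iff₀ (by positivity)]
    nlinarith
  let q : ℕ → (Fin d → ℝ) → ℝ := fun n x => g (ns n) x + δ * w x
  have hq0 : ∀ n x, 0 < q n x := fun n x => add_pos_of_nonneg_of_pos (hg0 _ x) (mul_pos hδ (hw0 x))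
  have hqlow : ∀ n x, δ * w x ≤ q n x := fun n x => le_add_of_nonneg_left (hg0 _ x)
  have hqc : ∀ n, Continuous (q n) := fun n => (hgc _).add (hwc.const_mul δ)
  have hmain : Tendsto (fun n => ∫ x, max (Real.log (f x) - Real.log (q n x)) 0 ∂μ) atTop
      (𝓝 (∫ _, (0 : ℝ) ∂μ)) := by
    refine tendsto_integral_of_dominated_convergence
      (fun x => |Real.log (f x)| + (|Real.log δ| + |Real.log (w x)|))
      (fun n => ((hf.log.sub (hqc n).measurable.log).max measurable_const).aestronglyMeasurable)
      (hlog.abs.add ((integrable_const _).add hw.abs)) ?_ ?_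
    · intro n
      refine ae_of_all _ fun x => ?_
      rw [Real.norm_of_nonneg (le_max_right _ _)]
      have h2 : Real.log δ + Real.log (w x) ≤ Real.log (q n x) := by
        rw [← Real.log_mul hδ.ne' (hw0 x).ne']
        exact Real.log_le_log (mul_pos hδ (hw0 x)) (hqlow n x)
      refine max_le ?_ (by positivity)
      linarith [le_abs_self (Real.log (f x)), neg_abs_le (Real.log δ),
        neg_abs_le (Real.log (w x))]
    · filter_upwards [hac.ae_le hae, hfpos] with x hx hfx
      have hpos : 0 < f x + δ * w x := add_pos hfx (mul_pos hδ (hw0 x))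
      have h1 : Tendsto (fun n => max (Real.log (f x) - Real.log (q n x)) 0) atTop
          (𝓝 (max (Real.log (f x) - Real.log (f x + δ * w x)) 0)) :=
        (tendsto_const_nhds.sub ((hx.add_const (δ * w x)).log hpos.ne')).max tendsto_const_nhds
      rwa [max_eq_right] at h1
      exact sub_nonpos.2 (Real.log_le_log hfx (le_add_of_nonneg_right (mul_pos hδ (hw0 x)).le))
  rw [integral_zero] at hmain
  have hev : ∀ᶠ n in atTop, ∫ x, max (Real.log (f x) - Real.log (q n x)) 0 ∂μ < η ∧
      ∫ x, g (ns n) x < 1 + η / 2 :=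
    (hmain.eventually_lt_const hη).and
      ((hmass.comp hns.tendsto_atTop).eventually_lt_const (by linarith))
  obtain ⟨n, hn1, hn2⟩ := hev.exists
  obtain ⟨B, hB⟩ := hgB (ns n)
  have hqB : ∀ y, q n y ≤ B + δ := fun y =>
    add_le_add (hB y) (mul_le_of_le_one_right hδ.le (hw1 y))
  have hqlogi : Integrable (fun x => Real.log (q n x)) μ := by
    refine (((integrable_const (|Real.log (B + δ)| + |Real.log δ|)).add hw.abs).mono'
      (hqc n).measurable.log.aestronglyMeasurable (ae_of_all _ fun x => ?_))
    have := abs_log_le_of_expSmoothing_le N μ (t := q n x) hδ x 0 (by simpa using hqlow n x) (hqB x)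
    simpa using this
  refine ⟨q n, δ, B + δ, hqc n, hδ, hqlow n, hqB, (hgi _).add (hwi.const_mul δ), ?_, ?_⟩
  · calc ∫ y, q n y = (∫ y, g (ns n) y) + δ * c := by
          rw [hc, ← integral_const_mul]
          exact integral_add (hgi _) (hwi.const_mul δ)
      _ ≤ 1 + η := by linarith
  · have hsub : ∫ x, Real.log (f x) ∂μ - ∫ x, Real.log (q n x) ∂μ ≤
        ∫ x, max (Real.log (f x) - Real.log (q n x)) 0 ∂μ := by
      rw [← integral_sub hlog hqlogi]
      exact integral_mono (hlog.sub hqlogi) (hlog.sub hqlogi).pos_part fun x => le_max_left _ _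
    linarith

end OutputDensity

/-! ### The limit of vanishing noise -/

section UpperBound

variable {d : ℕ} (N : Seminorm ℝ (Fin d → ℝ)) (hN : ∀ x, N x = 0 → x = 0) (hd : 1 ≤ d)
  {r s : ℝ} (hr : 0 < r) (hs : 0 < s)
include hN hd hr hs

/-- The logarithm of a density that dominates a multiple of the smoothed law is integrable along the
noisy observation, and as the noise is scaled down its mean tends to the mean at the input. -/
lemma tendsto_integral_log_add_noise {μ : Measure (Fin d → ℝ)} [IsProbabilityMeasure μ]
    (hw : Integrable (fun x => Real.log (expSmoothing N μ x)) μ) {q : (Fin d → ℝ) → ℝ} {δ B : ℝ}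
    (hq : Continuous q) (hδ : 0 < δ) (hlow : ∀ y, δ * expSmoothing N μ y ≤ q y)
    (hup : ∀ y, q y ≤ B) :
    (∀ t, 0 < t → Integrable (fun p : (Fin d → ℝ) × (Fin d → ℝ) => Real.log (q (p.1 + p.2)))
      (μ.prod (gibbsMeasure N r t))) ∧
    Tendsto (fun ε : ℝ => ∫ p, Real.log (q (p.1 + p.2)) ∂(μ.prod (gibbsMeasure N r (s / ε ^ r))))
      (𝓝[>] 0) (𝓝 (∫ x, Real.log (q x) ∂μ)) := by
  have hq0 : ∀ y, 0 < q y := fun y => (mul_pos hδ (expSmoothing_pos N μ y)).trans_le (hlow y)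
  have hlogc : Continuous fun p : (Fin d → ℝ) × (Fin d → ℝ) => Real.log (q (p.1 + p.2)) :=
    (hq.comp (continuous_fst.add continuous_snd)).log fun p => (hq0 _).ne'
  have hdom : ∀ t, 0 < t → Integrable (fun p : (Fin d → ℝ) × (Fin d → ℝ) =>
      |Real.log B| + |Real.log δ| + |Real.log (expSmoothing N μ p.1)| + N p.2)
      (μ.prod (gibbsMeasure N r t)) := by
    intro t ht
    have := isProbabilityMeasure_gibbsMeasure N hN hd hr ht
    exact ((integrable_const _).add (hw.abs.comp_fst _)).add
      ((integrable_seminorm_gibbsMeasure N hN hd hr ht).comp_snd μ)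
  refine ⟨fun t ht => (hdom t ht).mono' hlogc.aestronglyMeasurable (ae_of_all _ fun p =>
    abs_log_le_of_expSmoothing_le N μ hδ p.1 p.2 (hlow _) (hup _)), ?_⟩
  have hγ := isProbabilityMeasure_gibbsMeasure N hN hd hr hs
  have hscale : ∀ ε : ℝ, 0 < ε →
      ∫ p, Real.log (q (p.1 + p.2)) ∂(μ.prod (gibbsMeasure N r (s / ε ^ r))) =
        ∫ p, Real.log (q (p.1 + ε • p.2)) ∂(μ.prod (gibbsMeasure N r s)) := by
    intro ε hε
    have hsm : Measurable fun z : Fin d → ℝ => ε • z := measurable_const_smul ε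
    have hm : μ.prod (gibbsMeasure N r (s / ε ^ r)) =
        (μ.prod (gibbsMeasure N r s)).map (Prod.map id (ε • ·)) := by
      rw [← map_smul_gibbsMeasure N hN hd hr hs hε, ← Measure.map_prod_map _ _ measurable_id hsm,
        Measure.map_id]
    rw [hm, integral_map (measurable_id.prodMap hsm).aemeasurable hlogc.aestronglyMeasurable]
    rfl
  have hlimval : ∫ x, Real.log (q x) ∂μ = ∫ p, Real.log (q p.1) ∂(μ.prod (gibbsMeasure N r s)) := by
    rw [integral_fun_fst (fun x => Real.log (q x))]
    simp
  rw [hlimval]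
  refine Tendsto.congr' (f₁ := fun ε : ℝ =>
    ∫ p, Real.log (q (p.1 + ε • p.2)) ∂(μ.prod (gibbsMeasure N r s))) ?_ ?_
  · filter_upwards [self_mem_nhdsWithin] with ε hε
    exact (hscale ε hε).symm
  · refine tendsto_integral_filter_of_dominated_convergence _ ?_ ?_ (hdom s hs) ?_
    · refine Eventually.of_forall fun ε => Continuous.aestronglyMeasurable ?_
      exact (hq.comp (continuous_fst.add (continuous_snd.const_smul ε))).log fun p => (hq0 _).ne'
    · filter_upwards [self_mem_nhdsWithin, nhdsWithin_le_nhds (gt_mem_nhds one_pos)] with ε hε hε1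
      refine ae_of_all _ fun p => ?_
      refine (abs_log_le_of_expSmoothing_le N μ hδ p.1 (ε • p.2) (hlow _) (hup _)).trans ?_
      have hε0 : (0 : ℝ) < ε := hε
      have : N (ε • p.2) ≤ N p.2 := by
        rw [map_smul_eq_mul, Real.norm_of_nonneg hε0.le]
        exact mul_le_of_le_one_left (apply_nonneg N _) (le_of_lt hε1)
      linarith
    · refine ae_of_all _ fun p => ?_
      have hc : Continuous fun ε : ℝ => Real.log (q (p.1 + ε • p.2)) :=
        (hq.comp (by fun_prop)).log fun ε => (hq0 _).ne'
      have := (hc.tendsto 0).mono_left (nhdsWithin_le_nhds (s := Set.Ioi 0))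
      simpa using this

end UpperBound

/-! ### Asymptotics of the rate-distortion function -/

section RateDistortionFunction

variable {d : ℕ} {Ω : Type*} [MeasurableSpace Ω] {P : Measure Ω} [IsProbabilityMeasure P]
  {X : Ω → Fin d → ℝ}

lemma map_eq_withDensity_ofReal_pdf (hX : HasPDF X P volume) :
    P.map X = volume.withDensity fun x => ENNReal.ofReal (pdf X P volume x).toReal := by
  rw [map_eq_withDensity_pdf X P volume]
  exact withDensity_congr_ae pdf.ofReal_toReal_ae_eq.symm

lemma integrable_log_pdf (hX : HasPDF X P volume) (hh : Integrable (pdfLogPdf P X)) :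
    Integrable (fun x => Real.log (pdf X P volume x).toReal) (P.map X) := by
  rw [map_eq_withDensity_ofReal_pdf hX, integrable_withDensity_iff
    (measurable_pdf X P volume).ennreal_toReal.ennreal_ofReal
    (ae_of_all _ fun _ => ENNReal.ofReal_lt_top)]
  simp_rw [ENNReal.toReal_ofReal ENNReal.toReal_nonneg, mul_comm (Real.log _)]
  exact hh

lemma diffEntropy_eq (hX : HasPDF X P volume) :
    diffEntropy P X = -∫ x, Real.log (pdf X P volume x).toReal ∂(P.map X) := by
  rw [map_eq_withDensity_ofReal_pdf hX, integral_withDensity_eq_integral_toReal_smul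
    (measurable_pdf X P volume).ennreal_toReal.ennreal_ofReal
    (ae_of_all _ fun _ => ENNReal.ofReal_lt_top)]
  simp_rw [ENNReal.toReal_ofReal ENNReal.toReal_nonneg, smul_eq_mul]
  rfl

omit [IsProbabilityMeasure P] in
lemma floorEntropy_eq (hX : HasPDF X P volume) :
    floorEntropy P X = discreteEntropy ((P.map X).map floorVec) := by
  rw [floorEntropy, AEMeasurable.map_map_of_aemeasurable measurable_floorVec.aemeasurable
    (HasPDF.aemeasurable X P volume)]
  rfl

variable (hX : HasPDF X P volume) (N : Seminorm ℝ (Fin d → ℝ)) (hN : ∀ x, N x = 0 → x = 0)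
  {r : ℝ} (hr : 0 < r)
include hX hN hr

lemma shannonLowerBound_le_rateDistortion (hd : 1 ≤ d) (hh : Integrable (pdfLogPdf P X)) {D : ℝ}
    (hD : 0 < D) : (shannonLowerBound P X N r D : EReal) ≤ rateDistortion P X N r D := by
  have hμ : IsProbabilityMeasure (P.map X) :=
    Measure.isProbabilityMeasure_map (HasPDF.aemeasurable X P volume)
  have key : ENNReal.ofReal (shannonLowerBound P X N r D) ≤ rateDistortion P X N r D := by
    refine le_iInf fun κ => le_iInf fun hκ => le_iInf fun hdist => ?_
    by_cases htop : mutualInfo ((P.map X) ⊗ₘ κ) = ∞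
    · rw [htop]; exact le_top
    · refine ENNReal.ofReal_le_of_le_toReal ?_
      rw [shannonLowerBound_eq P X N hN hd hr hD, diffEntropy_eq hX]
      exact lower_bound_le_mutualInfo N hN hd hr hD (measurable_pdf X P volume).ennreal_toReal
        (fun _ => ENNReal.toReal_nonneg) (map_eq_withDensity_ofReal_pdf hX)
        (integrable_log_pdf hX hh) κ hdist htop
  calc (shannonLowerBound P X N r D : EReal)
      ≤ ((ENNReal.ofReal (shannonLowerBound P X N r D) : ℝ≥0∞) : EReal) := by
        rw [EReal.coe_ennreal_ofReal]
        exact_mod_cast le_max_left _ _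
    _ ≤ _ := by exact_mod_cast key

lemma rateDistortion_eq_top (hH : floorEntropy P X = ∞) (D : ℝ) :
    rateDistortion P X N r D = ∞ := by
  have hμ : IsProbabilityMeasure (P.map X) :=
    Measure.isProbabilityMeasure_map (HasPDF.aemeasurable X P volume)
  simp only [rateDistortion, iInf_eq_top]
  intro κ hκ hdist
  by_contra htop
  exact discreteEntropy_floorVec_ne_top N hN hr κ (ne_top_of_le_ne_top ENNReal.ofReal_ne_top hdist)
    htop (floorEntropy_eq hX ▸ hH)

lemma eventually_rateDistortion_le (hd : 1 ≤ d) (hh : Integrable (pdfLogPdf P X))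
    (hH : floorEntropy P X < ∞) {η : ℝ} (hη : 0 < η) :
    ∀ᶠ D in 𝓝[>] (0 : ℝ), rateDistortion P X N r D ≠ ∞ ∧
      (rateDistortion P X N r D).toReal ≤ shannonLowerBound P X N r D + η := by
  have hμ : IsProbabilityMeasure (P.map X) :=
    Measure.isProbabilityMeasure_map (HasPDF.aemeasurable X P volume)
  have hd' : (0 : ℝ) < d := by exact_mod_cast hd
  have hw : Integrable (fun x => Real.log (expSmoothing N (P.map X) x)) (P.map X) :=
    integrable_log_expSmoothing N (P.map X) (floorEntropy_eq hX ▸ hH.ne)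
  obtain ⟨q, δ, B, hqc, hδ, hlow, hup, hqi, hmass, hent⟩ :=
    exists_continuous_output_density N hN (measurable_pdf X P volume).ennreal_toReal
      (fun _ => ENNReal.toReal_nonneg) (map_eq_withDensity_ofReal_pdf hX)
      (integrable_log_pdf hX hh) hw (η := η / 3) (by positivity)
  rw [← diffEntropy_eq hX] at hent
  have hq0 : ∀ y, 0 < q y := fun y =>
    (mul_pos hδ (expSmoothing_pos N (P.map X) y)).trans_le (hlow y)
  obtain ⟨hlogi, hlim⟩ := tendsto_integral_log_add_noise N hN hd hr
    (s := d / r) (by positivity) hw hqc hδ hlow hup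
  -- the noise of scale `D ^ (1 / r)` has `r`-th moment `D`
  have hpow : Tendsto (fun D : ℝ => D ^ (1 / r)) (𝓝[>] 0) (𝓝[>] 0) := by
    refine tendsto_nhdsWithin_iff.2 ⟨?_, ?_⟩
    · have h := (Real.continuousAt_rpow_const 0 (1 / r) (Or.inr (by positivity))).tendsto
      rw [Real.zero_rpow (by positivity)] at h
      exact h.mono_left nhdsWithin_le_nhds
    · filter_upwards [self_mem_nhdsWithin] with D hD
      exact Real.rpow_pos_of_pos hD _
  have hev := (hlim.comp hpow).eventually_const_lt
    (show ∫ x, Real.log (q x) ∂(P.map X) - η / 3 < ∫ x, Real.log (q x) ∂(P.map X) by linarith)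
  filter_upwards [hev, self_mem_nhdsWithin] with D hDlog hD
  have hD0 : (0 : ℝ) < D := hD
  have hscale : d / r / (D ^ (1 / r)) ^ r = d / (r * D) := by
    rw [← Real.rpow_mul hD0.le, one_div_mul_cancel hr.ne', Real.rpow_one, div_div]
  simp only [Function.comp_apply, hscale] at hDlog
  have hs : 0 < d / (r * D) := by positivity
  have hγ := isProbabilityMeasure_gibbsMeasure N hN hd hr hs
  have hκ := isMarkovKernel_additiveNoise (gibbsMeasure N r (d / (r * D)))
  obtain ⟨htop, hle⟩ := toReal_mutualInfo_additiveNoise_le N hN hd hr hs (P.map X)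
    hqc.measurable hq0 hqi (hlogi _ hs)
  have hdist : expectedDistortion N r
      ((P.map X) ⊗ₘ additiveNoise (gibbsMeasure N r (d / (r * D)))) ≤ ENNReal.ofReal D := by
    rw [expectedDistortion_additiveNoise N hN hd hr hs]
    refine ENNReal.ofReal_le_ofReal (le_of_eq ?_)
    field_simp
  have hR : rateDistortion P X N r D ≤
      mutualInfo ((P.map X) ⊗ₘ additiveNoise (gibbsMeasure N r (d / (r * D)))) :=
    iInf_le_of_le _ (iInf_le_of_le hκ (iInf_le_of_le hdist le_rfl))
  refine ⟨ne_top_of_le_ne_top htop hR, (ENNReal.toReal_mono htop hR).trans ?_⟩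
  rw [shannonLowerBound_eq P X N hN hd hr hD0]
  linarith

lemma slbAsymptoticallyTight (hd : 1 ≤ d) (hh : Integrable (pdfLogPdf P X))
    (hH : floorEntropy P X < ∞) : SLBAsymptoticallyTight P X N r := by
  rw [SLBAsymptoticallyTight, tendsto_order]
  refine ⟨fun a ha => ?_, fun b hb => ?_⟩
  · filter_upwards [self_mem_nhdsWithin] with D hD
    refine ha.trans_le ?_
    rw [EReal.le_sub_iff_add_le (Or.inl (EReal.coe_ne_bot _)) (Or.inl (EReal.coe_ne_top _)),
      zero_add]
    exact shannonLowerBound_le_rateDistortion hX N hN hr hd hh hD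
  · obtain ⟨η, hη0, hηb⟩ := EReal.lt_iff_exists_real_btwn.1 hb
    filter_upwards [eventually_rateDistortion_le hX N hN hr hd hh hH
      (η := η) (by exact_mod_cast hη0)] with D hD
    refine lt_of_le_of_lt ?_ hηb
    rw [← EReal.coe_ennreal_toReal hD.1, ← EReal.coe_sub]
    exact_mod_cast (by linarith [hD.2] :
      (rateDistortion P X N r D).toReal - shannonLowerBound P X N r D ≤ η)

lemma not_slbAsymptoticallyTight (hH : floorEntropy P X = ∞) :
    ¬ SLBAsymptoticallyTight P X N r := by
  intro h
  have htop : (fun D : ℝ => (rateDistortion P X N r D : EReal)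
      - ((shannonLowerBound P X N r D : ℝ) : EReal)) = fun _ => ⊤ := by
    funext D
    rw [rateDistortion_eq_top hX N hN hr hH, EReal.coe_ennreal_top, EReal.top_sub_coe]
  rw [SLBAsymptoticallyTight, htop] at h
  exact EReal.top_ne_zero (tendsto_nhds_unique tendsto_const_nhds h)

end RateDistortionFunction

end RateDistortion

theorem theorem2 {d : ℕ} (hd : 1 ≤ d)
    {Ω : Type*} [MeasurableSpace Ω] (P : Measure Ω) [IsProbabilityMeasure P]
    (X : Ω → Fin d → ℝ) (hX : HasPDF X P volume)
    (hh : Integrable (RateDistortion.pdfLogPdf P X) volume)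
    (N : Seminorm ℝ (Fin d → ℝ)) (hN : ∀ x, N x = 0 → x = 0)
    (r : ℝ) (hr : 0 < r) :
    (RateDistortion.floorEntropy P X < ∞ →
      RateDistortion.SLBAsymptoticallyTight P X N r) ∧
    (RateDistortion.floorEntropy P X = ∞ →
      ∀ D : ℝ, 0 < D → RateDistortion.rateDistortion P X N r D = ∞) ∧
    (RateDistortion.SLBAsymptoticallyTight P X N r ↔
      RateDistortion.floorEntropy P X < ∞) := by
  have htight := RateDistortion.slbAsymptoticallyTight hX N hN hr hd hh
  refine ⟨htight, fun hH D _ => RateDistortion.rateDistortion_eq_top hX N hN hr hH D,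
    fun h => ?_, htight⟩
  by_contra hH
  exact RateDistortion.not_slbAsymptoticallyTight hX N hN hr (not_lt_top_iff.1 hH) h
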